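/- Setting. There are $d$ items. A stream of length $n$ in the general turnstile model is any sequence $x=(x^1,\dots,x^n)$ with $x^t\in\{-1,0,1\}^d$, where $x_i^t=1$ (resp. $-1$) means that item $i$ is inserted (resp. deleted) at time $t$. Put $f^t_i(x)=1$ if $\sum_{t'\le t}x_i^{t'}>0$ and $f^t_i(x)=0$ otherwise, so that $f^0_i(x)=0$. Let $\mathrm{CountDistinct}(x)^t=\sum_{i=1}^d f^t_i(x)$, and let the total flippancy of $x$ be $\sum_{i=1}^d\sum_{t=1}^{n}\mathbb 1\big(f^t_i(x)\ne f^{t-1}_i(x)\big)$. Two streams of the same length are item-level neighbouring if there is an item $i^*$ such that they agree on all updates of all items $i\neq i^*$. A (randomized, continual observation) algorithm produces at each time $t$ a real output $a^t$ that depends only on $x^1,\dots,x^t$ and on its own random choices. It is item-level $(\epsilon,\delta)$-differentially private for streams of length at most $T$ if for every $n\le T$, all item-level neighbouring streams $x,y$ of length $n$ and every measurable $S\subseteq\mathbb R^n$ the output sequence $A(x)=(a^1,\dots,a^n)$ satisfies $\Pr[A(x)\in S]\le e^{\epsilon}\Pr[A(y)\in S]+\delta$; it is item-level $\epsilon$-differentially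 private if this holds with $\delta=0$. Privacy is required on all streams, whatever their flippancy. We say that it has error at most $\alpha$ with probability at least $1-\beta$ (for given $T,K$) if for every stream $x$ of length $n\le T$ and total flippancy at most $K$, with probability at least $1-\beta$, $|a^t-\mathrm{CountDistinct}(x)^t|\le\alpha$ holds for all $t\le n$ simultaneously. Theorem 3.1. Let the number of items $d\ge1$, the bound $T\ge1$ on the number of time steps, the bound $K\ge 0$ (an integer) on the total flippancy and the failure probability $\beta\in(0,1)$ be known to the algorithm. 1. There is an absolute constant $C>0$ such that for all such $d,T,K,\beta$ and all $\epsilon>0$ there is an item-level $\epsilon$-differentially private algorithm (for streams of length at most $T$) which, with probability at least $1-\beta$, has error at most $$C\cdot\min\Big(d,\;K,\;\sqrt{\epsilon^{-1}K\ln(T/\beta)},\;\epsilon^{-1}T\ln(T/\beta)\Big).$$ 2. For every $\delta_0\in(0,1)$ there is a constant $C>0$, depending only on $\delta_0$, such that for all such $d,T,K,\beta$, all $\epsilon\in(0,1)$ and all $\delta\in(0,\delta_0]$ there is an item-level $(\epsilon,\delta)$-differentially private algorithm (for streams of length at most $T$) which, with probability at least $1-\beta$, has error at most $$C\cdot\min\Big(d,\;K,\;\big(\epsilon^{-2}K\ln(1/\delta)\ln^2(T/\beta)\big)^{1/3},\;\epsilon^{-1}\sqrt{T\ln(1/\delta)\ln(T/\beta)}\Big).$$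 -/

import Mathlib

namespace CountDistinct

/-- One update: entry `i` is `1` if item `i` is inserted, `-1` if it is deleted, `0` otherwise
(`SignType` is the three-element type `{-1, 0, 1}`). Several entries may be non-zero. -/
abbrev Update (d : ℕ) : Type := Fin d → SignType

/-- An input stream of length `n` in the general turnstile model; the update of time step
`t + 1` is `x t`, for `t = 0, …, n - 1`. No restriction on the counts is imposed. -/
abbrev Stream (d n : ℕ) : Type := Fin n → Update d

/-- The (possibly negative) count of item `i` after the first `t` time steps.
It is `0` for `t = 0`. -/
def itemCount {d n : ℕ} (x : Stream d n) (i : Fin d) (t : ℕ) : ℤ :=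
  ∑ s : Fin n, if (s : ℕ) < t then ((x s i : SignType) : ℤ) else 0

/-- The number of distinct elements after the first `t` time steps: the number of items
with a positive count. -/
def countDistinct {d n : ℕ} (x : Stream d n) (t : ℕ) : ℕ :=
  (Finset.univ.filter fun i : Fin d => 0 < itemCount x i t).card

/-- The total flippancy: the number of pairs of an item and a time step `t + 1 ∈ {1, …, n}` at
which the item switches from absent to present or from present to absent. Before the stream
starts every item is absent, so an insertion in time step `1` counts. -/
def flippancy {d n : ℕ} (x : Stream d n) : ℕ :=
  ∑ i : Fin d,
    (Finset.univ.filter fun t : Fin n =>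
      ¬ (0 < itemCount x i ((t : ℕ) + 1) ↔ 0 < itemCount x i (t : ℕ))).card

/-- Item-level neighbours: the two streams agree on all updates of all items but one. -/
def ItemNeighbor {d n : ℕ} (x y : Stream d n) : Prop :=
  ∃ i₀ : Fin d, ∀ (t : Fin n) (i : Fin d), i ≠ i₀ → x t i = y t i

/-- A randomized algorithm in the continual observation model, for streams over `d` items. Its
random choices are an outcome `ω` of a probability space, and its output in time step `t` is a
(measurable) function of `ω` and of the first `t` updates only. -/
structure ContinualAlgorithm (d : ℕ) where
  /-- the space of outcomes of the random choices -/
  Ω : Type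
  /-- its measurable sets -/
  mΩ : MeasurableSpace Ω
  /-- the law of the random choices -/
  P : MeasureTheory.Measure Ω
  isProb : MeasureTheory.IsProbabilityMeasure P
  /-- the output in time step `t`, given the first `t` updates -/
  out : (t : ℕ) → Stream d t → Ω → ℝ
  measurable_out : ∀ (t : ℕ) (x : Stream d t), Measurable (out t x)

namespace ContinualAlgorithm

attribute [instance] ContinualAlgorithm.mΩ ContinualAlgorithm.isProb

/-- The sequence of all outputs on the stream `x`: entry `t` is the output of time step `t + 1`,
computed from the first `t + 1` updates. -/
def run {d n : ℕ} (A : ContinualAlgorithm d) (x : Stream d n) (ω : A.Ω) : Fin n → ℝ :=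
  fun t => A.out ((t : ℕ) + 1) (fun s => x (Fin.castLE t.isLt s)) ω

/-- Item-level `(ε, δ)`-differential privacy, of the whole sequence of outputs, on streams of
length at most `T`; it is `ε`-differential privacy for `δ = 0`. -/
def IsItemLevelDP {d : ℕ} (A : ContinualAlgorithm d) (T : ℕ) (ε δ : ℝ) : Prop :=
  ∀ n : ℕ, n ≤ T → ∀ x y : Stream d n, ItemNeighbor x y →
    ∀ S : Set (Fin n → ℝ), MeasurableSet S →
      A.P {ω | A.run x ω ∈ S} ≤
        ENNReal.ofReal (Real.exp ε) * A.P {ω | A.run y ω ∈ S} + ENNReal.ofReal δ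

/-- On every stream of length at most `T` and total flippancy at most `K`, with probability at
least `1 - β` the additive error is at most `α` in all time steps simultaneously. -/
def HasErrorAtMost {d : ℕ} (A : ContinualAlgorithm d) (T K : ℕ) (β α : ℝ) : Prop :=
  ∀ n : ℕ, n ≤ T → ∀ x : Stream d n, flippancy x ≤ K →
    ENNReal.ofReal (1 - β) ≤
      A.P {ω | ∀ t : Fin n, |A.run x ω t - (countDistinct x ((t : ℕ) + 1) : ℝ)| ≤ α}

end ContinualAlgorithm

end CountDistinct

open MeasureTheory ProbabilityTheory
open scoped ENNReal NNReal

namespace CountDistinct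

/-! ### Product noise and its translates -/

/-! Changing one item moves the number of distinct elements by at most 1 at every time, and the
variation of that number over time is at most the flippancy. So it suffices to release privately a
real sequence of sup-sensitivity 1 and variation at most K (`achievable_of_sequence`), and each term
of the minimum gets its own mechanism.

The constant output 0 gives min(d, K). Independent noise in every time step gives the terms in T,
since the sequence has ℓ¹-sensitivity T (Laplace) and ℓ²-sensitivity √T (Gaussian).

For the terms in K the output is refreshed only when the count has moved away from it by more than
the noise plus α. Each refresh uses up more than α of the variation, so a budget of c refreshes
suffices once K ≤ cα (`lazy_update_error`). In the pure case the sparse vector technique pays for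
refreshes only, with noise of scale c/ε; balancing c ln(T/β)/ε against K/c gives the square root.

In the approximate case noise of scale √(c ln(1/δ))/ε is enough, and balancing gives the cube root.
The mechanism adds Laplace noise to every count and discards the noisy value unless it is far from
the current output. Its privacy is the inequality P(S) ≤ τ P'(S) + τ⁻ᵏ Bᵐ for all τ > 0, with m the
remaining budget, proved by induction over time (`maskRun_le`). In one step, the moment of order k +
1 of the likelihood ratio has first-order terms that cancel between releasing and discarding. Its
second-order terms are proportional to the probability of a release and are paid for by the factor B
that each release gives up (`mask_moment_le`, `mask_step_le`). Hence T does not enter the privacy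
cost. -/

lemma pi_withDensity {ι : Type*} [Fintype ι] (ν : ι → Measure ℝ) [∀ i, IsProbabilityMeasure (ν i)]
    (r : ι → ℝ → ℝ≥0∞) (hr : ∀ i, Measurable (r i))
    [∀ i, SigmaFinite ((ν i).withDensity (r i))] :
    Measure.pi (fun i => (ν i).withDensity (r i)) =
      (Measure.pi ν).withDensity (fun z => ∏ i, r i (z i)) := by
  refine Measure.pi_eq fun s hs => ?_
  rw [withDensity_apply _ (MeasurableSet.univ_pi hs), ← lintegral_indicator (MeasurableSet.univ_pi hs)]
  have h1 : ∀ z : ι → ℝ, (Set.univ.pi s).indicator (fun z => ∏ i, r i (z i)) z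
      = ∏ i, (s i).indicator (r i) (z i) := by
    intro z
    by_cases hz : z ∈ Set.univ.pi s
    · rw [Set.indicator_of_mem hz]
      exact Finset.prod_congr rfl fun i _ => (Set.indicator_of_mem (hz i trivial) _).symm
    · rw [Set.indicator_of_notMem hz]
      obtain ⟨i, hi⟩ : ∃ i, z i ∉ s i := by simpa [Set.mem_pi] using hz
      exact (Finset.prod_eq_zero (Finset.mem_univ i) (Set.indicator_of_notMem hi _)).symm
  simp_rw [h1]
  have hm : ∀ i, Measurable ((s i).indicator (r i)) := fun i => (hr i).indicator (hs i)
  rw [lintegral_prod_eq_prod_lintegral_of_indepFun Finset.univ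
    (fun i (z : ι → ℝ) => (s i).indicator (r i) (z i))
    (iIndepFun_pi (μ := ν) (X := fun i => (s i).indicator (r i)) fun i => (hm i).aemeasurable)
    (fun i => (hm i).comp (measurable_pi_apply i))]
  refine Finset.prod_congr rfl fun i _ => ?_
  rw [withDensity_apply _ (hs i), ← lintegral_indicator (hs i)]
  have := (measurePreserving_eval ν i).lintegral_comp (hm i)
  simpa using this

lemma map_add_withDensity (p : ℝ → ℝ≥0∞) (v : ℝ) :
    ((volume : Measure ℝ).withDensity p).map (fun x => x + v)
      = (volume : Measure ℝ).withDensity (fun x => p (x - v)) := by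
  ext s hs
  have hm : Measurable (fun x : ℝ => x + v) := by fun_prop
  rw [Measure.map_apply hm hs, withDensity_apply _ (hm hs), withDensity_apply _ hs,
    ← lintegral_indicator (hm hs), ← lintegral_indicator hs,
    ← lintegral_add_right_eq_self (s.indicator fun x => p (x - v)) v]
  refine lintegral_congr fun x => ?_
  by_cases h : x + v ∈ s
  · rw [Set.indicator_of_mem (show x ∈ (fun x => x + v) ⁻¹' s from h), Set.indicator_of_mem h,
      add_sub_cancel_right]
  · rw [Set.indicator_of_notMem (show x ∉ (fun x => x + v) ⁻¹' s from h),
      Set.indicator_of_notMem h]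

/-- The law of independent noise with density `p`, translated by `v`, expressed through the
likelihood ratio. -/
lemma pi_translate {ι : Type*} [Fintype ι] {p : ℝ → ℝ≥0∞} (hp : Measurable p)
    [IsProbabilityMeasure ((volume : Measure ℝ).withDensity p)]
    (r : ℝ → ℝ → ℝ≥0∞) (hr : ∀ v, Measurable (r v)) (hpr : ∀ v x, p (x - v) = p x * r v x)
    (v : ι → ℝ) {E : Set (ι → ℝ)} (hE : MeasurableSet E) :
    Measure.pi (fun _ : ι => (volume : Measure ℝ).withDensity p) {z | z + v ∈ E} =
      ∫⁻ z in E, ∏ i, r (v i) (z i) ∂Measure.pi (fun _ : ι => volume.withDensity p) := by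
  set ν := (volume : Measure ℝ).withDensity p with hν
  have h1 : ∀ w, ν.map (fun x => x + w) = ν.withDensity (r w) := by
    intro w
    rw [hν, map_add_withDensity p, ← withDensity_mul _ hp (hr w)]
    congr 1
    ext x
    exact hpr w x
  have hprob : ∀ w, IsProbabilityMeasure (ν.map (fun x => x + w)) := fun w =>
    Measure.isProbabilityMeasure_map (by fun_prop)
  have hprob' : ∀ w, IsProbabilityMeasure (ν.withDensity (r w)) := fun w => h1 w ▸ hprob w
  have hm : Measurable (fun z : ι → ℝ => z + v) := by fun_prop
  have h2 : (Measure.pi (fun _ : ι => ν)).map (fun z => z + v) =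
      (Measure.pi (fun _ : ι => ν)).withDensity (fun z => ∏ i, r (v i) (z i)) := by
    have := Measure.pi_map_pi (μ := fun _ : ι => ν) (f := fun i x => x + v i)
      (fun i => by fun_prop)
    rw [← pi_withDensity _ _ fun i => hr (v i)]
    simp_rw [h1] at this
    exact this
  rw [← withDensity_apply _ hE, ← h2, Measure.map_apply hm hE]
  rfl

/-! ### Laplace noise -/

/-- The density of the centred Laplace distribution of scale `b`. -/
noncomputable def laplacePDF (b x : ℝ) : ℝ := (2 * b)⁻¹ * Real.exp (-(|x| / b))

lemma laplacePDF_pos {b : ℝ} (hb : 0 < b) (x : ℝ) : 0 < laplacePDF b x := by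
  unfold laplacePDF; positivity

lemma measurable_laplacePDF (b : ℝ) : Measurable (laplacePDF b) := by
  unfold laplacePDF; fun_prop

/-- The centred Laplace distribution of scale `b`. -/
noncomputable def laplace (b : ℝ) : Measure ℝ :=
  volume.withDensity fun x => ENNReal.ofReal (laplacePDF b x)

lemma laplace_Ioi {b a : ℝ} (hb : 0 < b) (ha : 0 ≤ a) :
    laplace b (Set.Ioi a) = ENNReal.ofReal (Real.exp (-(a / b)) / 2) := by
  have h1 : ∫ x in Set.Ioi a, laplacePDF b x = Real.exp (-(a / b)) / 2 := by
    have : Set.EqOn (laplacePDF b) (fun x => (2 * b)⁻¹ * Real.exp (-b⁻¹ * x)) (Set.Ioi a) := by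
      intro x hx
      have hx' : 0 ≤ x := ha.trans (le_of_lt hx)
      simp only [laplacePDF, abs_of_nonneg hx']
      congr 2
      ring
    rw [setIntegral_congr_fun measurableSet_Ioi this, integral_const_mul,
      integral_exp_mul_Ioi (by simpa using hb)]
    have : -b⁻¹ * a = -(a / b) := by ring
    rw [this]
    field_simp
  have h2 : IntegrableOn (laplacePDF b) (Set.Ioi a) := by
    -- A non-integrable function has Bochner integral 0, but `h1` evaluates the integral to a
    -- positive number.
    by_contra h
    rw [integral_undef h] at h1
    have := Real.exp_pos (-(a / b))
    linarith
  rw [laplace, withDensity_apply _ measurableSet_Ioi, ← h1,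
    ofReal_integral_eq_lintegral_ofReal h2 (ae_of_all _ fun x => (laplacePDF_pos hb x).le)]

lemma laplace_Iio {b a : ℝ} (hb : 0 < b) (ha : 0 ≤ a) :
    laplace b (Set.Iio (-a)) = ENNReal.ofReal (Real.exp (-(a / b)) / 2) := by
  rw [← laplace_Ioi hb ha, laplace, withDensity_apply _ measurableSet_Ioi,
    withDensity_apply _ measurableSet_Iio, ← lintegral_indicator measurableSet_Ioi,
    ← lintegral_indicator measurableSet_Iio,
    ← (Measure.measurePreserving_neg (volume : Measure ℝ)).lintegral_comp_emb
      (MeasurableEquiv.neg ℝ).measurableEmbedding]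
  refine lintegral_congr fun x => ?_
  simp only [Set.indicator, Set.mem_Iio, Set.mem_Ioi, neg_lt_neg_iff, laplacePDF, abs_neg]

lemma laplace_abs_gt {b a : ℝ} (hb : 0 < b) (ha : 0 ≤ a) :
    laplace b {x | a < |x|} = ENNReal.ofReal (Real.exp (-(a / b))) := by
  have : {x : ℝ | a < |x|} = Set.Ioi a ∪ Set.Iio (-a) := by
    ext x
    simp only [Set.mem_ofPred_eq, lt_abs, Set.mem_union, Set.mem_Ioi, Set.mem_Iio]
    constructor <;> rintro (h | h) <;> [left; right; left; right] <;> linarith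
  rw [this, measure_union _ measurableSet_Iio, laplace_Ioi hb ha, laplace_Iio hb ha,
    ← ENNReal.ofReal_add (by positivity) (by positivity), add_halves]
  refine Set.disjoint_left.2 fun x hx hx' => ?_
  simp only [Set.mem_Ioi, Set.mem_Iio] at hx hx'
  linarith

lemma isProbabilityMeasure_laplace {b : ℝ} (hb : 0 < b) : IsProbabilityMeasure (laplace b) := by
  refine ⟨?_⟩
  have h0 : laplace b {0} = 0 :=
    (withDensity_absolutelyContinuous _ _ : laplace b ≪ volume) (by simp)
  have h1 := laplace_abs_gt hb le_rfl
  have h2 : (Set.univ : Set ℝ) = {x : ℝ | 0 < |x|} ∪ {0} := by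
    ext x
    by_cases h : x = 0 <;> simp [h]
  apply le_antisymm
  · rw [h2]
    refine (measure_union_le _ _).trans ?_
    rw [h0, h1]
    simp
  · rw [show (1 : ℝ≥0∞) = laplace b {x | 0 < |x|} by rw [h1]; simp]
    exact measure_mono (Set.subset_univ _)

/-- Independent Laplace noise. -/
noncomputable def laplacePi (ι : Type*) [Fintype ι] (b : ℝ) : Measure (ι → ℝ) :=
  Measure.pi fun _ => laplace b

lemma isProbabilityMeasure_laplacePi (ι : Type*) [Fintype ι] {b : ℝ} (hb : 0 < b) :
    IsProbabilityMeasure (laplacePi ι b) := by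
  have := isProbabilityMeasure_laplace hb
  unfold laplacePi
  infer_instance

lemma laplacePDF_sub (b v x : ℝ) :
    laplacePDF b (x - v) = laplacePDF b x * Real.exp ((|x| - |x - v|) / b) := by
  simp only [laplacePDF]
  rw [mul_assoc, ← Real.exp_add]
  congr 2
  ring

/-- Translating independent Laplace noise costs at most the `ℓ¹` norm over the scale. -/
lemma laplacePi_translate_le {ι : Type*} [Fintype ι] {b ε : ℝ} (hb : 0 < b) (v : ι → ℝ)
    (hv : ∑ i, |v i| ≤ ε * b) {E : Set (ι → ℝ)} (hE : MeasurableSet E) :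
    laplacePi ι b {z | z + v ∈ E} ≤ ENNReal.ofReal (Real.exp ε) * laplacePi ι b E := by
  have := isProbabilityMeasure_laplace hb
  unfold laplacePi laplace at *
  rw [pi_translate (measurable_laplacePDF b).ennreal_ofReal
    (fun v x => ENNReal.ofReal (Real.exp ((|x| - |x - v|) / b))) (fun v => by fun_prop)
    (fun v x => by rw [laplacePDF_sub, ENNReal.ofReal_mul (laplacePDF_pos hb x).le]) v hE,
    ← setLIntegral_const]
  refine lintegral_mono fun z => ?_
  rw [← ENNReal.ofReal_prod_of_nonneg fun i _ => (Real.exp_pos _).le, ← Real.exp_sum]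
  refine ENNReal.ofReal_le_ofReal (Real.exp_le_exp.2 ?_)
  rw [← Finset.sum_div, div_le_iff₀ hb]
  refine le_trans (Finset.sum_le_sum fun i _ => ?_) hv
  have := abs_sub_abs_le_abs_sub (z i) (z i - v i)
  simpa using this

/-- A union bound over identically distributed coordinates. -/
lemma pi_exists_abs_gt_le {ι : Type*} [Fintype ι] (ν : Measure ℝ) [IsProbabilityMeasure ν]
    (a : ℝ) :
    Measure.pi (fun _ : ι => ν) {z | ∃ i, a < |z i|} ≤ Fintype.card ι * ν {x | a < |x|} := by
  have h : {z : ι → ℝ | ∃ i, a < |z i|} = ⋃ i, Function.eval i ⁻¹' {x | a < |x|} := by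
    ext z; simp
  rw [h]
  refine (measure_iUnion_fintype_le _ _).trans ?_
  have hs : MeasurableSet {x : ℝ | a < |x|} := measurableSet_lt (by fun_prop) (by fun_prop)
  rw [Finset.sum_congr rfl fun i _ => (measurePreserving_eval (fun _ : ι => ν) i).measure_preimage
    hs.nullMeasurableSet]
  simp

/-- Only subadditivity is used, so neither the good event nor the bad event has to be shown
measurable. -/
lemma one_sub_le_of_compl {Ω : Type*} [MeasurableSpace Ω] (μ : Measure Ω) [IsProbabilityMeasure μ]
    {s t : Set Ω} {β : ℝ} (hβ : 0 ≤ β) (hst : sᶜ ⊆ t) (ht : μ t ≤ ENNReal.ofReal β) :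
    ENNReal.ofReal (1 - β) ≤ μ s := by
  rw [ENNReal.ofReal_sub _ hβ, ENNReal.ofReal_one, tsub_le_iff_right]
  calc (1 : ℝ≥0∞) = μ Set.univ := measure_univ.symm
    _ ≤ μ (s ∪ t) := measure_mono fun x _ => by
        by_cases h : x ∈ s
        · exact Or.inl h
        · exact Or.inr (hst h)
    _ ≤ μ s + μ t := measure_union_le _ _
    _ ≤ _ := by gcongr

/-- With probability at least `1 - β` all of the Laplace variables are small. -/
lemma laplacePi_concentration {ι : Type*} [Fintype ι] [Nonempty ι] {b β : ℝ} (hb : 0 < b)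
    (hβ : 0 < β) (hβ1 : β < 1) :
    laplacePi ι b {z | ∃ i, b * Real.log (Fintype.card ι / β) < |z i|} ≤ ENNReal.ofReal β := by
  have := isProbabilityMeasure_laplace hb
  have hc : (1 : ℝ) ≤ Fintype.card ι := by exact_mod_cast Fintype.card_pos
  have hlog : 0 ≤ Real.log (Fintype.card ι / β) := by
    apply Real.log_nonneg
    rw [le_div_iff₀ hβ]
    linarith
  refine (pi_exists_abs_gt_le (laplace b) _).trans ?_
  rw [laplace_abs_gt hb (by positivity), mul_div_cancel_left₀ _ hb.ne', Real.exp_neg,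
    Real.exp_log (by positivity), ← ENNReal.ofReal_natCast, ← ENNReal.ofReal_mul (by positivity)]
  apply ENNReal.ofReal_le_ofReal
  field_simp
  rfl

/-! ### Gaussian noise -/

lemma hasSubgaussianMGF_gaussianReal (s : ℝ≥0) : HasSubgaussianMGF id s (gaussianReal 0 s) where
  integrable_exp_mul t := integrable_exp_mul_gaussianReal t
  mgf_le t := by simp [mgf_id_gaussianReal]

lemma gaussianReal_abs_gt_le {s : ℝ≥0} {a : ℝ} (ha : 0 ≤ a) :
    gaussianReal 0 s {x | a < |x|} ≤ ENNReal.ofReal (2 * Real.exp (-a ^ 2 / (2 * s))) := by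
  have h := hasSubgaussianMGF_gaussianReal s
  have h1 := h.measure_ge_le ha
  have h2 := h.neg.measure_ge_le ha
  have h3 : {x : ℝ | a < |x|} ⊆ {x | a ≤ id x} ∪ {x | a ≤ (-id) x} := by
    intro x hx
    rcases lt_abs.1 (show a < |x| from hx) with h | h
    · exact Or.inl h.le
    · exact Or.inr h.le
  refine (measure_mono h3).trans ((measure_union_le _ _).trans ?_)
  rw [two_mul, ENNReal.ofReal_add (Real.exp_pos _).le (Real.exp_pos _).le]
  rw [measureReal_def] at h1 h2
  exact add_le_add (ENNReal.le_ofReal_iff_toReal_le (measure_ne_top _ _) (Real.exp_pos _).le |>.2 h1)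
    (ENNReal.le_ofReal_iff_toReal_le (measure_ne_top _ _) (Real.exp_pos _).le |>.2 h2)

/-- Independent centred Gaussian noise of variance `s`. -/
noncomputable def gaussianPi (ι : Type*) [Fintype ι] (s : ℝ≥0) : Measure (ι → ℝ) :=
  Measure.pi fun _ => gaussianReal 0 s

instance (ι : Type*) [Fintype ι] (s : ℝ≥0) : IsProbabilityMeasure (gaussianPi ι s) := by
  unfold gaussianPi; infer_instance

/-- A linear form in independent Gaussians is subgaussian with parameter `s * ∑ v i ^ 2`, and the
Chernoff bound does the rest. Working with an upper bound `V > 0` keeps `v = 0` admissible. -/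
lemma gaussianPi_inner_ge_le {ι : Type*} [Fintype ι] (s : ℝ≥0) (v : ι → ℝ) {V L : ℝ}
    (hs : s ≠ 0) (hV : ∑ i, v i ^ 2 ≤ V) (hV0 : 0 < V) (hL : 0 ≤ L) :
    gaussianPi ι s {z | Real.sqrt (2 * s * V * L) ≤ ∑ i, v i * z i} ≤
      ENNReal.ofReal (Real.exp (-L)) := by
  have hs' : (0 : ℝ) < s := by exact_mod_cast pos_iff_ne_zero.2 hs
  have hind : iIndepFun (fun i (z : ι → ℝ) => v i * z i) (gaussianPi ι s) :=
    iIndepFun_pi (μ := fun _ : ι => gaussianReal 0 s) (X := fun i x => v i * x)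
      fun i => by fun_prop
  let c : ι → ℝ≥0 := fun i => ⟨v i ^ 2, sq_nonneg _⟩ * s
  have hsub : ∀ i ∈ (Finset.univ : Finset ι),
      HasSubgaussianMGF (fun z : ι → ℝ => v i * z i) (c i)
        (gaussianPi ι s) := by
    intro i _
    refine HasSubgaussianMGF.const_mul (X := fun z : ι → ℝ => z i) ?_ (v i)
    have := hasSubgaussianMGF_gaussianReal s
    rw [← (measurePreserving_eval (fun _ : ι => gaussianReal 0 s) i).map_eq] at this
    exact (HasSubgaussianMGF.id_map_iff (measurable_pi_apply i).aemeasurable).1 this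
  have h := HasSubgaussianMGF.sum_of_iIndepFun hind hsub
  have h' : HasSubgaussianMGF (fun z : ι → ℝ => ∑ i, v i * z i) (⟨V, hV0.le⟩ * s)
      (gaussianPi ι s) := by
    refine ⟨h.integrable_exp_mul, fun t => (h.mgf_le t).trans (Real.exp_le_exp.2 ?_)⟩
    have : ((∑ i, c i : ℝ≥0) : ℝ) ≤ V * s := by
      rw [NNReal.coe_sum]
      refine (Finset.sum_mul _ _ _).symm.trans_le ?_
      exact mul_le_mul_of_nonneg_right hV hs'.le
    have h2 : ((⟨V, hV0.le⟩ * s : ℝ≥0) : ℝ) = V * s := rfl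
    rw [h2]
    gcongr
  have h1 := h'.measure_ge_le (Real.sqrt_nonneg (2 * s * V * L))
  rw [Real.sq_sqrt (by positivity)] at h1
  have h2 : -(2 * s * V * L) / (2 * ((⟨V, hV0.le⟩ * s : ℝ≥0) : ℝ)) = -L := by
    have : ((⟨V, hV0.le⟩ * s : ℝ≥0) : ℝ) = V * s := rfl
    rw [this]
    field_simp
  rw [h2, measureReal_def] at h1
  exact (ENNReal.le_ofReal_iff_toReal_le (measure_ne_top _ _) (Real.exp_pos _).le).2 h1

/-- The Gaussian mechanism. -/
lemma gaussianPi_translate_le {ι : Type*} [Fintype ι] {s : ℝ≥0} (hs : s ≠ 0) (v : ι → ℝ)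
    {V L ε : ℝ} (hV : ∑ i, v i ^ 2 ≤ V) (hV0 : 0 < V) (hL : 0 ≤ L)
    (hε : V / 2 + Real.sqrt (2 * s * V * L) ≤ ε * s) {E : Set (ι → ℝ)} (hE : MeasurableSet E) :
    gaussianPi ι s {z | z + v ∈ E} ≤
      ENNReal.ofReal (Real.exp ε) * gaussianPi ι s E + ENNReal.ofReal (Real.exp (-L)) := by
  have hs' : (0 : ℝ) < s := by exact_mod_cast pos_iff_ne_zero.2 hs
  have hg : gaussianReal 0 s = volume.withDensity (gaussianPDF 0 s) :=
    gaussianReal_of_var_ne_zero 0 hs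
  have hprob : IsProbabilityMeasure ((volume : Measure ℝ).withDensity (gaussianPDF 0 s)) :=
    hg ▸ inferInstance
  let r : ℝ → ℝ → ℝ≥0∞ := fun v x => ENNReal.ofReal (Real.exp ((2 * x * v - v ^ 2) / (2 * s)))
  have hr : ∀ v, Measurable (r v) := fun v => by fun_prop
  have hpr : ∀ v x, gaussianPDF 0 s (x - v) = gaussianPDF 0 s x * r v x := by
    intro v x
    simp only [gaussianPDF, r]
    rw [← ENNReal.ofReal_mul (gaussianPDFReal_nonneg _ _ _)]
    simp only [gaussianPDFReal]
    rw [mul_assoc _ (Real.exp _), ← Real.exp_add]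
    congr 3
    ring
  have htr : ∀ {E : Set (ι → ℝ)}, MeasurableSet E → gaussianPi ι s {z | z + v ∈ E} =
      ∫⁻ z in E, ∏ i, r (v i) (z i) ∂gaussianPi ι s := by
    intro E hE
    have := pi_translate (measurable_gaussianPDF 0 s) r hr hpr v hE
    rwa [← hg] at this
  have hprod : ∀ z : ι → ℝ, ∏ i, r (v i) (z i) =
      ENNReal.ofReal (Real.exp (∑ i, (2 * z i * v i - v i ^ 2) / (2 * s))) := by
    intro z
    rw [Real.exp_sum, ENNReal.ofReal_prod_of_nonneg fun i _ => (Real.exp_pos _).le]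
  -- The event that the log-likelihood ratio exceeds `ε`. Off `B` the ratio is at most `exp ε`; the
  -- mass of `B` under the translated law becomes `δ`.
  let B : Set (ι → ℝ) := {z | ε < ∑ i, (2 * z i * v i - v i ^ 2) / (2 * s)}
  have hB : MeasurableSet B := measurableSet_lt (by fun_prop) (by fun_prop)
  have hBmeas : gaussianPi ι s {z | z + v ∈ B} ≤ ENNReal.ofReal (Real.exp (-L)) := by
    refine (measure_mono fun z hz => ?_).trans (gaussianPi_inner_ge_le s v hs hV hV0 hL)
    have hz' : ε < ∑ i, (2 * (z i + v i) * v i - v i ^ 2) / (2 * s) := hz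
    have h1 : ∑ i, (2 * (z i + v i) * v i - v i ^ 2) / (2 * s) =
        (2 * (∑ i, v i * z i) + ∑ i, v i ^ 2) / (2 * s) := by
      rw [← Finset.sum_div, Finset.mul_sum, ← Finset.sum_add_distrib]
      congr 1
      exact Finset.sum_congr rfl fun i _ => by ring
    rw [h1, lt_div_iff₀ (by positivity)] at hz'
    show Real.sqrt (2 * s * V * L) ≤ ∑ i, v i * z i
    linarith
  rw [htr hE]
  calc ∫⁻ z in E, ∏ i, r (v i) (z i) ∂gaussianPi ι s
      ≤ ∫⁻ z in E, (ENNReal.ofReal (Real.exp ε) + B.indicator (fun z => ∏ i, r (v i) (z i)) z)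
          ∂gaussianPi ι s := by
        refine lintegral_mono fun z => ?_
        by_cases hz : z ∈ B
        · rw [Set.indicator_of_mem hz]
          exact le_add_self
        · rw [Set.indicator_of_notMem hz, add_zero, hprod]
          exact ENNReal.ofReal_le_ofReal (Real.exp_le_exp.2 (not_lt.1 hz))
    _ = ENNReal.ofReal (Real.exp ε) * gaussianPi ι s E +
          ∫⁻ z in E, B.indicator (fun z => ∏ i, r (v i) (z i)) z ∂gaussianPi ι s := by
        rw [lintegral_add_left measurable_const, setLIntegral_const]
    _ ≤ ENNReal.ofReal (Real.exp ε) * gaussianPi ι s E +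
          ∫⁻ z, B.indicator (fun z => ∏ i, r (v i) (z i)) z ∂gaussianPi ι s := by
        exact add_le_add le_rfl (setLIntegral_le_lintegral _ _)
    _ ≤ _ := by
        -- The likelihood ratio integrated over `B` is again the translated law of `B`.
        rw [lintegral_indicator hB, ← htr hB]
        gcongr

/-- With probability at least `1 - β` all of the Gaussian variables are small. -/
lemma gaussianPi_concentration {ι : Type*} [Fintype ι] [Nonempty ι] {s : ℝ≥0} {β : ℝ} (hs : s ≠ 0)
    (hβ : 0 < β) (hβ1 : β < 1) :
    gaussianPi ι s {z | ∃ i, Real.sqrt (2 * s * Real.log (2 * Fintype.card ι / β)) < |z i|} ≤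
      ENNReal.ofReal β := by
  have hs' : (0 : ℝ) < s := by exact_mod_cast pos_iff_ne_zero.2 hs
  have hc : (1 : ℝ) ≤ Fintype.card ι := by exact_mod_cast Fintype.card_pos
  have hlog : 0 ≤ Real.log (2 * Fintype.card ι / β) := by
    apply Real.log_nonneg
    rw [le_div_iff₀ hβ]
    linarith
  refine (pi_exists_abs_gt_le (gaussianReal 0 s) _).trans ?_
  refine (mul_le_mul_right (gaussianReal_abs_gt_le (Real.sqrt_nonneg _)) _).trans ?_
  rw [Real.sq_sqrt (by positivity), neg_div, mul_div_cancel_left₀ _ (by positivity), Real.exp_neg,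
    Real.exp_log (by positivity), ← ENNReal.ofReal_natCast, ← ENNReal.ofReal_mul (by positivity)]
  apply ENNReal.ofReal_le_ofReal
  field_simp
  rfl

/-! ### The sequence of counts -/

lemma itemCount_castLE {d m n : ℕ} (h : m ≤ n) (x : Stream d n) (i : Fin d) {t : ℕ} (ht : t ≤ m) :
    itemCount (fun s => x (Fin.castLE h s)) i t = itemCount x i t := by
  refine Finset.sum_of_injOn (Fin.castLE h) (Fin.castLE_injective h).injOn
    (fun _ _ => Finset.mem_coe.2 (Finset.mem_univ _)) (fun s _ hs => ?_) (fun s _ => rfl)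
  refine if_neg fun hst => hs ?_
  exact ⟨⟨s, hst.trans_le ht⟩, Finset.mem_coe.2 (Finset.mem_univ _), rfl⟩

lemma countDistinct_castLE {d m n : ℕ} (h : m ≤ n) (x : Stream d n) {t : ℕ} (ht : t ≤ m) :
    countDistinct (fun s => x (Fin.castLE h s)) t = countDistinct x t := by
  simp only [countDistinct, itemCount_castLE h x _ ht]

lemma countDistinct_zero {d n : ℕ} (x : Stream d n) : countDistinct x 0 = 0 := by
  simp [countDistinct, itemCount]

lemma countDistinct_le {d n : ℕ} (x : Stream d n) (t : ℕ) : countDistinct x t ≤ d :=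
  (Finset.card_le_univ _).trans_eq (Fintype.card_fin d)

lemma countDistinct_succ_of_le {d n : ℕ} (x : Stream d n) {t : ℕ} (ht : n ≤ t) :
    countDistinct x (t + 1) = countDistinct x t := by
  have h : ∀ i, itemCount x i (t + 1) = itemCount x i t := fun i =>
    Finset.sum_congr rfl fun s _ => by
      rw [if_pos (s.isLt.trans_le (ht.trans t.le_succ)), if_pos (s.isLt.trans_le ht)]
  simp only [countDistinct, h]

lemma ItemNeighbor.symm {d n : ℕ} {x y : Stream d n} (h : ItemNeighbor x y) : ItemNeighbor y x := by
  obtain ⟨i₀, h⟩ := h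
  exact ⟨i₀, fun t i hi => (h t i hi).symm⟩

lemma ItemNeighbor.countDistinct_le {d n : ℕ} {x y : Stream d n} (h : ItemNeighbor x y) (t : ℕ) :
    countDistinct x t ≤ countDistinct y t + 1 := by
  obtain ⟨i₀, h⟩ := h
  refine (Finset.card_le_card fun i hi => ?_).trans (Finset.card_insert_le i₀ _)
  rw [Finset.mem_filter] at hi
  by_cases hi₀ : i = i₀
  · exact hi₀ ▸ Finset.mem_insert_self _ _
  · refine Finset.mem_insert_of_mem (Finset.mem_filter.2 ⟨Finset.mem_univ _, ?_⟩)
    have : itemCount x i t = itemCount y i t :=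
      Finset.sum_congr rfl fun s _ => by rw [h s i hi₀]
    exact this ▸ hi.2

lemma ItemNeighbor.abs_sub_le {d n : ℕ} {x y : Stream d n} (h : ItemNeighbor x y) (t : ℕ) :
    |(countDistinct x t : ℝ) - countDistinct y t| ≤ 1 := by
  have h1 : (countDistinct x t : ℝ) ≤ countDistinct y t + 1 := by
    exact_mod_cast h.countDistinct_le t
  have h2 : (countDistinct y t : ℝ) ≤ countDistinct x t + 1 := by
    exact_mod_cast h.symm.countDistinct_le t
  rw [abs_le]
  constructor <;> linarith

lemma abs_card_filter_sub_le {α : Type*} [Fintype α] [DecidableEq α] (p q : α → Prop)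
    [DecidablePred p] [DecidablePred q] :
    |((Finset.univ.filter p).card : ℝ) - (Finset.univ.filter q).card| ≤
      (Finset.univ.filter fun a => ¬ (p a ↔ q a)).card := by
  have h : ∀ (p q : α → Prop) [DecidablePred p] [DecidablePred q],
      ((Finset.univ.filter p).card : ℝ) ≤ (Finset.univ.filter q).card +
        (Finset.univ.filter fun a => ¬ (p a ↔ q a)).card := by
    intro p q _ _
    have : (Finset.univ.filter p).card ≤ (Finset.univ.filter q).card +
        (Finset.univ.filter fun a => ¬ (p a ↔ q a)).card := by
      refine (Finset.card_le_card fun a ha => ?_).trans (Finset.card_union_le _ _)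
      simp only [Finset.mem_union, Finset.mem_filter, Finset.mem_univ, true_and] at ha ⊢
      tauto
    exact_mod_cast this
  have h1 := h p q
  have h2 := h q p
  simp only [iff_comm (a := q _)] at h2
  rw [abs_le]
  constructor <;> linarith

/-- A change of the count by `r` in one step needs at least `r` items to flip. The count is frozen
after the end of the stream, so the sum may run up to `T`, whatever the length `n`. -/
lemma sum_abs_countDistinct_le_flippancy {d n : ℕ} (x : Stream d n) (T : ℕ) :
    ∑ s ∈ Finset.range T, |(countDistinct x (s + 1) : ℝ) - countDistinct x s| ≤ flippancy x := by
  have h1 : ∀ s ∈ Finset.range T, |(countDistinct x (s + 1) : ℝ) - countDistinct x s| ≠ 0 →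
      s < n := by
    intro s _ hs
    by_contra hn
    rw [countDistinct_succ_of_le x (not_lt.1 hn)] at hs
    simp at hs
  rw [← Finset.sum_filter_of_ne h1]
  calc ∑ s ∈ (Finset.range T).filter (· < n), |(countDistinct x (s + 1) : ℝ) - countDistinct x s|
      ≤ ∑ s ∈ Finset.range n, |(countDistinct x (s + 1) : ℝ) - countDistinct x s| :=
        Finset.sum_le_sum_of_subset_of_nonneg
          (fun s hs => Finset.mem_range.2 (Finset.mem_filter.1 hs).2) fun _ _ _ => abs_nonneg _
    _ = ∑ s : Fin n, |(countDistinct x ((s : ℕ) + 1) : ℝ) - countDistinct x s| :=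
        (Fin.sum_univ_eq_sum_range
          (fun s => |(countDistinct x (s + 1) : ℝ) - countDistinct x s|) n).symm
    _ ≤ ∑ s : Fin n, ((Finset.univ.filter fun i : Fin d =>
          ¬ (0 < itemCount x i ((s : ℕ) + 1) ↔ 0 < itemCount x i (s : ℕ))).card : ℝ) :=
        Finset.sum_le_sum fun s _ => abs_card_filter_sub_le _ _
    _ = flippancy x := by
        simp only [flippancy, Finset.card_filter, Nat.cast_sum]
        exact Finset.sum_comm

/-! ### Algorithms that depend on the stream through its counts only -/

/-- The properties of the count sequences of streams over `d` items with flippancy at most `K`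
that the error analysis uses. -/
structure IsCountSequence (d T K : ℕ) (f : ℕ → ℝ) : Prop where
  zero : f 0 = 0
  nonneg : ∀ t, 0 ≤ f t
  le : ∀ t, f t ≤ d
  variation : ∑ s ∈ Finset.range T, |f (s + 1) - f s| ≤ K

/-- There is a private algorithm with error at most `α`. -/
def Achievable (d T K : ℕ) (ε δ β α : ℝ) : Prop :=
  ∃ A : ContinualAlgorithm d, A.IsItemLevelDP T ε δ ∧ A.HasErrorAtMost T K β α

lemma Achievable.mono {d T K : ℕ} {ε δ δ' β α α' : ℝ} (h : Achievable d T K ε δ β α)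
    (hδ : δ ≤ δ') (hα : α ≤ α') : Achievable d T K ε δ' β α' := by
  obtain ⟨A, h1, h2⟩ := h
  refine ⟨A, fun n hn x y hxy S hS => (h1 n hn x y hxy S hS).trans ?_, fun n hn x hx =>
    (h2 n hn x hx).trans (measure_mono fun ω hω t => (hω t).trans hα)⟩
  gcongr

/-- Neighbouring streams enter only through count sequences at sup-distance at most 1, so `hdp` asks
for nothing about flippancy. A mechanism for `T` steps also serves shorter streams: by causality a
run on a prefix agrees with the full run, and dropping outputs is post-processing. -/
lemma achievable_of_sequence {d T K : ℕ} {ε δ β α : ℝ} {Ω : Type} [MeasurableSpace Ω]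
    (P : Measure Ω) [IsProbabilityMeasure P] (g : (ℕ → ℝ) → Ω → ℕ → ℝ)
    (hg : ∀ f t, Measurable fun ω => g f ω t)
    (hcausal : ∀ f f' ω t, (∀ s ≤ t, f s = f' s) → g f ω t = g f' ω t)
    (hdp : ∀ f f' : ℕ → ℝ, (∀ s, |f s - f' s| ≤ 1) → ∀ S : Set (Fin T → ℝ), MeasurableSet S →
      P {ω | (fun i : Fin T => g f ω (i + 1)) ∈ S} ≤
        ENNReal.ofReal (Real.exp ε) * P {ω | (fun i : Fin T => g f' ω (i + 1)) ∈ S} +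
          ENNReal.ofReal δ)
    (herr : ∀ f, IsCountSequence d T K f →
      ENNReal.ofReal (1 - β) ≤ P {ω | ∀ t < T, |g f ω (t + 1) - f (t + 1)| ≤ α}) :
    Achievable d T K ε δ β α := by
  let A : ContinualAlgorithm d :=
    { Ω := Ω
      mΩ := inferInstance
      P := P
      isProb := inferInstance
      out := fun t x ω => g (fun s => countDistinct x s) ω t
      measurable_out := fun t x => hg _ t }
  have hrun : ∀ {n : ℕ} (x : Stream d n) (ω : Ω) (t : Fin n),
      A.run x ω t = g (fun s => countDistinct x s) ω (t + 1) := fun x ω t =>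
    hcausal _ _ _ _ fun s hs => by rw [countDistinct_castLE t.isLt x hs]
  refine ⟨A, ?_, ?_⟩
  · intro n hn x y hxy S hS
    have hr : Measurable fun (w : Fin T → ℝ) (i : Fin n) => w (Fin.castLE hn i) := by fun_prop
    have h := hdp (fun s => countDistinct x s) (fun s => countDistinct y s) hxy.abs_sub_le
      _ (hr hS)
    have h' : ∀ x : Stream d n, {ω | A.run x ω ∈ S} = {ω | (fun i : Fin T =>
        g (fun s => countDistinct x s) ω (i + 1)) ∈
          (fun (w : Fin T → ℝ) (i : Fin n) => w (Fin.castLE hn i)) ⁻¹' S} := by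
      intro x
      ext ω
      have : A.run x ω = fun i : Fin n => g (fun s => countDistinct x s) ω (i + 1) :=
        funext fun i => hrun x ω i
      show A.run x ω ∈ S ↔ _
      rw [this]
      rfl
    rw [h', h']
    exact h
  · intro n hn x hx
    refine (herr (fun s => countDistinct x s) ⟨by simp [countDistinct_zero],
      fun t => Nat.cast_nonneg _, fun t => by exact_mod_cast countDistinct_le x t,
      (sum_abs_countDistinct_le_flippancy x T).trans (by exact_mod_cast hx)⟩).trans
      (measure_mono fun ω hω t => ?_)
    rw [hrun]
    exact hω t (t.isLt.trans_le hn)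

/-! ### Three simple mechanisms -/

lemma IsCountSequence.le_variation {d T K : ℕ} {f : ℕ → ℝ} (hf : IsCountSequence d T K f) {t : ℕ}
    (ht : t ≤ T) : f t ≤ K := by
  calc f t = ∑ s ∈ Finset.range t, (f (s + 1) - f s) := by
        rw [Finset.sum_range_sub, hf.zero, sub_zero]
    _ ≤ ∑ s ∈ Finset.range t, |f (s + 1) - f s| := Finset.sum_le_sum fun _ _ => le_abs_self _
    _ ≤ ∑ s ∈ Finset.range T, |f (s + 1) - f s| :=
        Finset.sum_le_sum_of_subset_of_nonneg (Finset.range_mono ht) fun _ _ _ => abs_nonneg _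
    _ ≤ K := hf.variation

/-- The algorithm that always outputs `0`. -/
lemma achievable_zero (d T K : ℕ) {ε β : ℝ} (hε : 0 ≤ ε) (hβ : 0 < β) :
    Achievable d T K ε 0 β (min (d : ℝ) K) := by
  refine achievable_of_sequence (Measure.dirac ()) (fun _ _ _ => 0) (fun _ _ => measurable_const)
    (fun _ _ _ _ _ => rfl) (fun f f' _ S _ => ?_) (fun f hf => ?_)
  · refine le_add_right (le_mul_of_one_le_left' ?_)
    rw [ENNReal.one_le_ofReal]
    exact Real.one_le_exp hε
  · have : {ω : Unit | ∀ t < T, |(0 : ℝ) - f (t + 1)| ≤ min (d : ℝ) K} = Set.univ := by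
      refine Set.eq_univ_of_forall fun _ t ht => ?_
      rw [zero_sub, abs_neg, abs_of_nonneg (hf.nonneg _)]
      exact le_min (hf.le _) (hf.le_variation ht)
    rw [this, measure_univ, ENNReal.ofReal_le_one]
    linarith

/-- A finite sequence, extended by zero. -/
def extendZero {n : ℕ} (z : Fin n → ℝ) (t : ℕ) : ℝ := if h : t < n then z ⟨t, h⟩ else 0

lemma extendZero_val {n : ℕ} (z : Fin n → ℝ) (i : Fin n) : extendZero z i = z i := by
  simp [extendZero]

lemma extendZero_of_lt {n : ℕ} (z : Fin n → ℝ) {t : ℕ} (h : t < n) : extendZero z t = z ⟨t, h⟩ :=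
  dif_pos h

lemma measurable_extendZero (n t : ℕ) : Measurable fun z : Fin n → ℝ => extendZero z t := by
  unfold extendZero
  split_ifs
  · exact measurable_pi_apply _
  · exact measurable_const

lemma abs_extendZero_le {n : ℕ} {z : Fin n → ℝ} {a : ℝ} (ha : 0 ≤ a) (hz : ∀ i, |z i| ≤ a)
    (t : ℕ) : |extendZero z t| ≤ a := by
  unfold extendZero
  split_ifs
  · exact hz _
  · simpa using ha

/-- Releasing each count with additive noise. -/
lemma achievable_additive {d T K : ℕ} {ε δ β α : ℝ} (P : Measure (Fin T → ℝ))
    [IsProbabilityMeasure P] (hβ : 0 ≤ β)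
    (hshift : ∀ v : Fin T → ℝ, (∀ i, |v i| ≤ 1) → ∀ E, MeasurableSet E →
      P {z | z + v ∈ E} ≤ ENNReal.ofReal (Real.exp ε) * P E + ENNReal.ofReal δ)
    (hconc : P {z | ∃ i, α < |z i|} ≤ ENNReal.ofReal β) : Achievable d T K ε δ β α := by
  -- Noise is indexed from 0 but outputs from 1, hence `t - 1`; the value at `t = 0` is not part of
  -- any run.
  refine achievable_of_sequence P (fun f z t => f t + extendZero z (t - 1))
    (fun f t => (measurable_extendZero T (t - 1)).const_add _)
    (fun f f' z t h => by rw [h t le_rfl]) (fun f f' hff' S hS => ?_) (fun f hf => ?_)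
  · have hm : MeasurableSet {z : Fin T → ℝ |
        (fun i : Fin T => f' (i + 1) + extendZero z ((i : ℕ) + 1 - 1)) ∈ S} := by
      have : Measurable fun (z : Fin T → ℝ) (i : Fin T) =>
          f' (i + 1) + extendZero z ((i : ℕ) + 1 - 1) :=
        measurable_pi_lambda _ fun i => (measurable_extendZero T _).const_add _
      exact this hS
    refine le_trans (le_of_eq ?_) (hshift (fun i => f (i + 1) - f' (i + 1))
      (fun i => hff' _) _ hm)
    congr 1
    ext z
    show _ ∈ S ↔ _ ∈ S
    have : (fun i : Fin T => f (i + 1) + extendZero z ((i : ℕ) + 1 - 1)) = fun i : Fin T =>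
        f' (i + 1) + extendZero (z + fun i : Fin T => f (i + 1) - f' (i + 1)) ((i : ℕ) + 1 - 1) := by
      funext i
      simp only [add_tsub_cancel_right, extendZero_val, Pi.add_apply]
      ring
    rw [this]
  · refine one_sub_le_of_compl P hβ (fun z hz => ?_) hconc
    by_contra hcon
    refine hz fun t ht => ?_
    have : ¬ ∃ i, α < |z i| := hcon
    push Not at this
    simpa [extendZero_of_lt z ht] using this ⟨t, ht⟩

/-- The logarithm here carries no extra constant inside, so this mechanism still meets the target
when `T = 1` and `β` is close to 1. -/
lemma achievable_laplace {d T K : ℕ} {ε β : ℝ} (hT : 0 < T) (hε : 0 < ε) (hβ : 0 < β)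
    (hβ1 : β < 1) : Achievable d T K ε 0 β (ε⁻¹ * T * Real.log (T / β)) := by
  have hT' : (0 : ℝ) < T := by exact_mod_cast hT
  have hb : 0 < ε⁻¹ * T := by positivity
  have := isProbabilityMeasure_laplacePi (Fin T) hb
  have : Nonempty (Fin T) := ⟨⟨0, hT⟩⟩
  refine achievable_additive (laplacePi (Fin T) (ε⁻¹ * T)) hβ.le (fun v hv E hE => ?_) ?_
  · refine le_add_right (laplacePi_translate_le hb v ?_ hE)
    refine (Finset.sum_le_sum fun i _ => hv i).trans ?_
    rw [← mul_assoc, mul_inv_cancel₀ hε.ne']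
    simp
  · have := laplacePi_concentration (ι := Fin T) hb hβ hβ1
    rwa [Fintype.card_fin] at this

lemma achievable_gaussian {d T K : ℕ} {ε β s L : ℝ} (hT : 0 < T) (hβ : 0 < β)
    (hβ1 : β < 1) (hs : 0 < s) (hL : 0 ≤ L)
    (hεs : (T : ℝ) / 2 + Real.sqrt (2 * s * T * L) ≤ ε * s) :
    Achievable d T K ε (Real.exp (-L)) β (Real.sqrt (2 * s * Real.log (2 * T / β))) := by
  have hT' : (0 : ℝ) < T := by exact_mod_cast hT
  lift s to ℝ≥0 using hs.le
  have hs0 : s ≠ 0 := by rintro rfl; simp at hs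
  have : Nonempty (Fin T) := ⟨⟨0, hT⟩⟩
  refine achievable_additive (gaussianPi (Fin T) s) hβ.le (fun v hv E hE => ?_) ?_
  · refine gaussianPi_translate_le hs0 v ?_ hT' hL hεs hE
    refine (Finset.sum_le_sum fun i _ => (sq_le_one_iff_abs_le_one _).2 (hv i)).trans ?_
    simp
  · have := gaussianPi_concentration (ι := Fin T) hs0 hβ hβ1
    rwa [Fintype.card_fin] at this

/-! ### Lazily updated outputs -/

/-- If the output `o` is refreshed only at times when the count has moved by more than `M + α`, up
to an error of at most `M`, then the budget `c` of refreshments is never used up. -/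
lemma lazy_update_error {d T K c : ℕ} {f o : ℕ → ℝ} {m : ℕ → ℕ} {M α R : ℝ}
    (hf : IsCountSequence d T K f) (hc : 0 < c) (hM : 0 ≤ M) (hMR : M ≤ R)
    (hK : (K : ℝ) ≤ c * α) (ho : o 0 = 0) (hm : m 0 = c)
    (hstep : ∀ t < T,
      (0 < m t ∧ m (t + 1) + 1 = m t ∧ |o (t + 1) - f (t + 1)| ≤ M ∧ M + α < |f (t + 1) - o t|) ∨
      (m (t + 1) = m t ∧ o (t + 1) = o t ∧ (0 < m t → |f (t + 1) - o t| ≤ R))) :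
    ∀ t < T, |o (t + 1) - f (t + 1)| ≤ R := by
  let V : ℕ → ℝ := fun s => ∑ i ∈ Finset.range s, |f (i + 1) - f i|
  have hVmono : Monotone V := fun a b hab =>
    Finset.sum_le_sum_of_subset_of_nonneg (Finset.range_mono hab) fun _ _ _ => abs_nonneg _
  have hVsub : ∀ s t, s ≤ t → |f t - f s| ≤ V t - V s := by
    intro s t hst
    induction t, hst using Nat.le_induction with
    | base => simp
    | succ t _ ih =>
      have h1 : V (t + 1) = V t + |f (t + 1) - f t| := Finset.sum_range_succ _ _
      have h2 := abs_sub_le (f (t + 1)) (f t) (f s)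
      linarith
  have inv : ∀ t ≤ T, ∃ s ≤ t, |o t - f s| ≤ M ∧
      (m t = c ∨ (m t ≤ c ∧ ((c : ℝ) - m t) * α < V s)) := by
    intro t
    induction t with
    | zero => exact fun _ => ⟨0, le_rfl, by simpa [ho, hf.zero] using hM, Or.inl hm⟩
    | succ t ih =>
      intro ht
      obtain ⟨s, hs, hos, hms⟩ := ih (by omega)
      rcases hstep t ht with ⟨h1, h2, h3, h4⟩ | ⟨h1, h2, _⟩
      · refine ⟨t + 1, le_rfl, h3, Or.inr ⟨by omega, ?_⟩⟩
        have h5 := hVsub s (t + 1) (by omega)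
        have h6 := abs_sub_le (f (t + 1)) (f s) (o t)
        rw [abs_sub_comm (f s)] at h6
        have h7 : (m (t + 1) : ℝ) = m t - 1 := by
          have : ((m (t + 1) + 1 : ℕ) : ℝ) = m t := by rw [h2]
          push_cast at this
          linarith
        have h8 : ((c : ℝ) - m t) * α ≤ V s := by
          rcases hms with h | ⟨_, h⟩
          · rw [h, sub_self, zero_mul]
            exact Finset.sum_nonneg fun _ _ => abs_nonneg _
          · exact h.le
        rw [h7]
        linarith
      · exact ⟨s, by omega, by rwa [h2], by rwa [h1]⟩
  intro t ht
  rcases hstep t ht with ⟨_, _, h, _⟩ | ⟨_, h2, h3⟩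
  · exact h.trans hMR
  · rw [h2, abs_sub_comm]
    apply h3
    obtain ⟨s, hs, _, h | ⟨_, h⟩⟩ := inv t ht.le
    · omega
    -- An exhausted budget would mean variation above `c * α`, hence above `K`.
    · by_contra h0
      have h0' : m t = 0 := by omega
      have h4 : V s ≤ K := (hVmono (hs.trans ht.le)).trans hf.variation
      rw [h0', Nat.cast_zero, sub_zero] at h
      linarith

/-! ### The sparse vector technique -/

/-- The sparse vector technique refreshes its output if the noisy distance of the count `y` from the
current output `s.1` exceeds the noisy threshold `thr + s.2.1`, while the budget `s.2.2` lasts. -/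
def SparseTrigger (thr : ℝ) (s : ℝ × ℝ × ℕ) (y ν : ℝ) : Prop :=
  0 < s.2.2 ∧ thr + s.2.1 < |y - s.1| + ν

open Classical in
/-- The state (output, threshold noise, remaining budget) of the sparse vector technique with
threshold noise `ρ`, query noise `ν` and output noise `η`. -/
noncomputable def sparseState (thr : ℝ) (c : ℕ) (f ρ ν η : ℕ → ℝ) : ℕ → ℝ × ℝ × ℕ
  | 0 => (0, ρ 0, c)
  | t + 1 =>
    if SparseTrigger thr (sparseState thr c f ρ ν η t) (f (t + 1)) (ν t) then
      (f (t + 1) + η t, ρ (t + 1), (sparseState thr c f ρ ν η t).2.2 - 1)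
    else sparseState thr c f ρ ν η t

/-- The sparse vector technique refreshes its output in time step `t + 1`. -/
def SparseJump (thr : ℝ) (c : ℕ) (f ρ ν η : ℕ → ℝ) (t : ℕ) : Prop :=
  SparseTrigger thr (sparseState thr c f ρ ν η t) (f (t + 1)) (ν t)

section

variable {thr : ℝ} {c : ℕ} {f f' ρ ν η ρ' ν' η' : ℕ → ℝ}

lemma sparseState_succ_of_jump {t : ℕ} (h : SparseJump thr c f ρ ν η t) :
    sparseState thr c f ρ ν η (t + 1) =
      (f (t + 1) + η t, ρ (t + 1), (sparseState thr c f ρ ν η t).2.2 - 1) := if_pos h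

lemma sparseState_succ_of_not_jump {t : ℕ} (h : ¬ SparseJump thr c f ρ ν η t) :
    sparseState thr c f ρ ν η (t + 1) = sparseState thr c f ρ ν η t := if_neg h

lemma sparseState_causal {t : ℕ} (h : ∀ s ≤ t, f s = f' s) :
    sparseState thr c f ρ ν η t = sparseState thr c f' ρ ν η t := by
  induction t with
  | zero => rfl
  | succ t ih =>
    rw [sparseState, sparseState, ih fun s hs => h s (by omega), h (t + 1) le_rfl]

open Classical in
lemma sparseState_budget (t : ℕ) :
    (sparseState thr c f ρ ν η t).2.2 +
      ((Finset.range t).filter (SparseJump thr c f ρ ν η)).card = c := by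
  induction t with
  | zero => simp [sparseState]
  | succ t ih =>
    rw [Finset.range_add_one, Finset.filter_insert]
    by_cases h : SparseJump thr c f ρ ν η t
    · rw [if_pos h, sparseState_succ_of_jump h, Finset.card_insert_of_notMem (by simp)]
      have := h.1
      simp only
      omega
    · rw [if_neg h, sparseState_succ_of_not_jump h, ih]

/-- Moving the noise suitably makes the sparse vector technique behave on `f'` as on `f`. -/
lemma sparseState_coupling {T : ℕ} (hff' : ∀ s, |f s - f' s| ≤ 1) (h0 : ρ' 0 = ρ 0 + 1)
    (hJ : ∀ t < T, SparseJump thr c f ρ ν η t →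
      ρ' (t + 1) = ρ (t + 1) + 1 ∧ ν' t = ν t + 2 ∧ η' t = η t + (f (t + 1) - f' (t + 1)))
    (hN : ∀ t < T, ¬ SparseJump thr c f ρ ν η t → ν' t = ν t) :
    ∀ t ≤ T, (sparseState thr c f' ρ' ν' η' t = ((sparseState thr c f ρ ν η t).1,
        (sparseState thr c f ρ ν η t).2.1 + 1, (sparseState thr c f ρ ν η t).2.2)) ∧
      ∀ s < t, (SparseJump thr c f' ρ' ν' η' s ↔ SparseJump thr c f ρ ν η s) := by
  intro t
  induction t with
  | zero => exact fun _ => ⟨by simp [sparseState, h0], by simp⟩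
  | succ t ih =>
    intro ht
    obtain ⟨ihs, ihj⟩ := ih (by omega)
    -- The queried distance moves by at most 1. Raising the threshold noise by 1 keeps every
    -- non-jump a non-jump; at a jump, raising the query noise by 2 makes up for both the threshold
    -- and the query.
    have habs : ∀ o, |(|f (t + 1) - o| - |f' (t + 1) - o|)| ≤ 1 := fun o =>
      (abs_abs_sub_abs_le_abs_sub _ _).trans (by simpa using hff' (t + 1))
    have key : SparseJump thr c f' ρ' ν' η' t ↔ SparseJump thr c f ρ ν η t := by
      have h1 := abs_le.1 (habs (sparseState thr c f ρ ν η t).1)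
      by_cases hj : SparseJump thr c f ρ ν η t
      · refine iff_of_true ?_ hj
        unfold SparseJump SparseTrigger at hj ⊢
        rw [ihs, (hJ t ht hj).2.1]
        refine ⟨hj.1, ?_⟩
        have := hj.2
        simp only
        linarith
      · refine iff_of_false ?_ hj
        unfold SparseJump SparseTrigger at hj ⊢
        rw [ihs, hN t ht hj]
        rintro ⟨h2, h3⟩
        refine hj ⟨h2, ?_⟩
        simp only at h3
        linarith
    refine ⟨?_, fun s hs => ?_⟩
    · by_cases hj : SparseJump thr c f ρ ν η t
      · rw [sparseState_succ_of_jump hj, sparseState_succ_of_jump (key.2 hj), ihs,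
          (hJ t ht hj).1, (hJ t ht hj).2.2]
        simp only [Prod.mk.injEq, and_true]
        ring
      · rw [sparseState_succ_of_not_jump hj, sparseState_succ_of_not_jump (mt key.1 hj), ihs]
    · rcases Nat.lt_succ_iff_lt_or_eq.1 hs with h | rfl
      · exact ihj s h
      · exact key

/-- The comparison involves two noises of size at most `M`. With threshold `3 * M + α`, a jump
certifies a true distance above `M + α`, and no jump a distance of at most `5 * M + α`. -/
lemma sparseState_error {d T K : ℕ} {M α : ℝ} (hf : IsCountSequence d T K f) (hc : 0 < c)
    (hα : 0 ≤ α) (hK : (K : ℝ) ≤ c * α) (hM : 0 ≤ M) (hρ : ∀ t, |ρ t| ≤ M) (hν : ∀ t, |ν t| ≤ M)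
    (hη : ∀ t, |η t| ≤ M) :
    ∀ t < T, |(sparseState (3 * M + α) c f ρ ν η (t + 1)).1 - f (t + 1)| ≤ 5 * M + α := by
  have hρs : ∀ t, |(sparseState (3 * M + α) c f ρ ν η t).2.1| ≤ M := by
    intro t
    induction t with
    | zero => exact hρ 0
    | succ t ih =>
      by_cases hj : SparseJump (3 * M + α) c f ρ ν η t
      · rw [sparseState_succ_of_jump hj]
        exact hρ _
      · rwa [sparseState_succ_of_not_jump hj]
  refine lazy_update_error (o := fun t => (sparseState (3 * M + α) c f ρ ν η t).1)
    (m := fun t => (sparseState (3 * M + α) c f ρ ν η t).2.2) (M := M) (α := α) hf hc hM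
    (by linarith) hK rfl rfl fun t _ => ?_
  have h1 := abs_le.1 (hρs t)
  have h2 := abs_le.1 (hν t)
  by_cases hj : SparseJump (3 * M + α) c f ρ ν η t
  · left
    have hb := hj.1
    have h3 := hj.2
    refine ⟨hb, ?_, ?_, by linarith⟩
    · simp only [sparseState_succ_of_jump hj]
      omega
    · simpa only [sparseState_succ_of_jump hj, add_sub_cancel_left] using hη t
  · right
    simp only [sparseState_succ_of_not_jump hj, true_and]
    intro hb
    have h3 : ¬ _ := fun h => hj ⟨hb, h⟩
    linarith [not_lt.1 h3]

end

lemma measurable_sparseState {Ω : Type*} [MeasurableSpace Ω] (thr : ℝ) (c : ℕ) (f : ℕ → ℝ)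
    {ρ ν η : Ω → ℕ → ℝ} (hρ : ∀ t, Measurable fun ω => ρ ω t) (hν : ∀ t, Measurable fun ω => ν ω t)
    (hη : ∀ t, Measurable fun ω => η ω t) (t : ℕ) :
    Measurable (fun ω => sparseState thr c f (ρ ω) (ν ω) (η ω) t) ∧
      MeasurableSet {ω | SparseJump thr c f (ρ ω) (ν ω) (η ω) t} := by
  have hjump : ∀ t, Measurable (fun ω => sparseState thr c f (ρ ω) (ν ω) (η ω) t) →
      MeasurableSet {ω | SparseJump thr c f (ρ ω) (ν ω) (η ω) t} := by
    intro t ht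
    refine MeasurableSet.inter (measurableSet_lt measurable_const ht.snd.snd) ?_
    exact measurableSet_lt (ht.snd.fst.const_add _)
      (((ht.fst.const_sub _).abs).add (hν t))
  suffices h : Measurable (fun ω => sparseState thr c f (ρ ω) (ν ω) (η ω) t) from ⟨h, hjump t h⟩
  induction t with
  | zero => exact measurable_const.prodMk ((hρ 0).prodMk measurable_const)
  | succ t ih =>
    exact Measurable.ite (hjump t ih) (((hη t).const_add _).prodMk
      ((hρ (t + 1)).prodMk ((measurable_of_countable fun k : ℕ => k - 1).comp ih.snd.snd))) ih

open Classical in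
/-- The noise translation of `sparseState_coupling` for the set `J` of jump times. -/
noncomputable def sparseShift (T : ℕ) (f f' : ℕ → ℝ) (J : Finset ℕ) (p : Fin 3 × Fin (T + 1)) : ℝ :=
  -- Threshold noise 0 is in force at the start, and noise `t + 1` is drawn at a jump in step `t`;
  -- this is why there are `T + 1` indices.
  if p.1 = 0 then (if (p.2 : ℕ) = 0 ∨ (p.2 : ℕ) - 1 ∈ J then 1 else 0)
  else if (p.2 : ℕ) ∈ J then (if p.1 = 1 then 2 else f (p.2 + 1) - f' (p.2 + 1)) else 0

/-- Each jump costs 1 for the new threshold, 2 for the query and 1 for the output; the initial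
threshold costs 1 more. -/
lemma sum_abs_sparseShift_le {T : ℕ} {f f' : ℕ → ℝ} (hff' : ∀ s, |f s - f' s| ≤ 1) {J : Finset ℕ}
    (hJ : J ⊆ Finset.range T) : ∑ p, |sparseShift T f f' J p| ≤ 4 * J.card + 1 := by
  classical
  have hcard : ∀ a : ℝ, ∑ i ∈ Finset.range T, (if i ∈ J then a else 0) = J.card * a := by
    intro a
    rw [Finset.sum_ite_mem, Finset.inter_eq_right.2 hJ]
    simp
  have hT : T ∉ J := fun h => by simpa using hJ h
  have h0 : ∑ i : Fin (T + 1), |sparseShift T f f' J (0, i)| = J.card + 1 := by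
    have : ∀ i : Fin (T + 1), |sparseShift T f f' J (0, i)| =
        (fun i : ℕ => if i = 0 ∨ i - 1 ∈ J then (1 : ℝ) else 0) i := by
      intro i
      simp only [sparseShift, if_true]
      split_ifs <;> simp
    simp_rw [this]
    rw [Fin.sum_univ_eq_sum_range (fun i : ℕ => if i = 0 ∨ i - 1 ∈ J then (1 : ℝ) else 0),
      Finset.sum_range_succ']
    simp [hcard 1]
  have h12 : ∀ k : Fin 3, k ≠ 0 → ∀ a : ℝ, (k = 1 → a = 2) → (k ≠ 1 → a = 1) →
      ∑ i : Fin (T + 1), |sparseShift T f f' J (k, i)| ≤ J.card * a := by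
    intro k hk a h1 h2
    have : ∀ i : Fin (T + 1), |sparseShift T f f' J (k, i)| ≤
        (fun i : ℕ => if i ∈ J then a else 0) i := by
      intro i
      simp only [sparseShift, if_neg hk]
      split_ifs with h3 h4
      · simp [h1 h4]
      · exact (hff' _).trans_eq (h2 h4).symm
      · simp
    refine (Finset.sum_le_sum fun i _ => this i).trans_eq ?_
    rw [Fin.sum_univ_eq_sum_range (fun i : ℕ => if i ∈ J then a else 0), Finset.sum_range_succ,
      hcard, if_neg hT, add_zero]
  rw [Fintype.sum_prod_type, Fin.sum_univ_three, h0]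
  have h1 := h12 1 (by decide) 2 (fun _ => rfl) (fun h => absurd rfl h)
  have h2 := h12 2 (by decide) 1 (fun h => absurd h (by decide)) (fun _ => rfl)
  linarith

/-- The sparse vector technique is private, and accurate if the budget `c` suffices. -/
lemma achievable_sparse {d T K c : ℕ} {ε β α : ℝ} (hε : 0 < ε) (hβ : 0 < β) (hβ1 : β < 1)
    (hc : 0 < c) (hα : 0 ≤ α) (hK : (K : ℝ) ≤ c * α) :
    Achievable d T K ε 0 β (5 * (5 * c / ε * Real.log (3 * (T + 1) / β)) + α) := by
  classical
  have hc' : (1 : ℝ) ≤ c := by exact_mod_cast hc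
  -- At most `c` jumps give a shift of `ℓ¹` norm at most `4 * c + 1 ≤ 5 * c`, hence the scale `5 * c
  -- / ε`.
  have hb : 0 < 5 * (c : ℝ) / ε := by positivity
  set M := 5 * c / ε * Real.log (3 * (T + 1) / β) with hMdef
  have hM : 0 ≤ M := by
    refine mul_nonneg hb.le (Real.log_nonneg ?_)
    rw [le_div_iff₀ hβ]
    have : (0 : ℝ) ≤ T := Nat.cast_nonneg _
    linarith
  let Z := Fin 3 × Fin (T + 1) → ℝ
  let P : Measure Z := laplacePi (Fin 3 × Fin (T + 1)) (5 * c / ε)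
  have : IsProbabilityMeasure P := isProbabilityMeasure_laplacePi _ hb
  let w : Fin 3 → Z → ℕ → ℝ := fun k z => extendZero fun i => z (k, i)
  have hw : ∀ k t, Measurable fun z => w k z t := fun k t =>
    (measurable_extendZero (T + 1) t).comp
      (measurable_pi_lambda (fun (z : Z) i => z (k, i)) fun i => measurable_pi_apply _)
  let st : (ℕ → ℝ) → Z → ℕ → ℝ × ℝ × ℕ := fun f z =>
    sparseState (3 * M + α) c f (w 0 z) (w 1 z) (w 2 z)
  let jp : (ℕ → ℝ) → Z → ℕ → Prop := fun f z =>
    SparseJump (3 * M + α) c f (w 0 z) (w 1 z) (w 2 z)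
  have hmeas := fun f t => measurable_sparseState (3 * M + α) c f (hw 0) (hw 1) (hw 2) t
  refine achievable_of_sequence P (fun f z t => (st f z t).1) (fun f t => (hmeas f t).1.fst)
    (fun f f' z t h => by simp only [st, sparseState_causal h]) (fun f f' hff' S hS => ?_)
    (fun f hf => ?_)
  · let run : (ℕ → ℝ) → Z → Fin T → ℝ := fun f z i => (st f z (i + 1)).1
    have hrun : ∀ f, Measurable (run f) := fun f =>
      measurable_pi_lambda _ fun i => (hmeas f (i + 1)).1.fst
    -- The translation depends on the noise only through the set of jump times. Splitting the event
    -- by that set leaves one constant translation on each piece.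
    let pat : (ℕ → ℝ) → Z → Finset ℕ := fun f z => (Finset.range T).filter (jp f z)
    have hpat : ∀ f J, MeasurableSet {z | pat f z = J} := by
      intro f J
      have : {z | pat f z = J} =
          ⋂ t : ℕ, {z | (t < T ∧ jp f z t) ↔ t ∈ J} := by
        ext z
        show pat f z = J ↔ _
        simp [pat, Finset.ext_iff]
      rw [this]
      refine MeasurableSet.iInter fun t => ?_
      exact ((MeasurableSet.const _).inter (hmeas f t).2).iff (MeasurableSet.const _)
    let E : (ℕ → ℝ) → Finset ℕ → Set Z := fun f J => {z | pat f z = J ∧ run f z ∈ S}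
    have hE : ∀ f J, MeasurableSet (E f J) := fun f J => (hpat f J).inter (hrun f hS)
    have hsub : ∀ f z, pat f z ∈ (Finset.range T).powerset := fun f z =>
      Finset.mem_powerset.2 (Finset.filter_subset _ _)
    have hUnion : ∀ f, {z | run f z ∈ S} = ⋃ J ∈ (Finset.range T).powerset, E f J := by
      intro f
      ext z
      simp only [Set.mem_iUnion]
      exact ⟨fun h => ⟨pat f z, hsub f z, rfl, h⟩, fun ⟨J, _, h⟩ => h.2⟩
    have hdisj : (↑((Finset.range T).powerset) : Set (Finset ℕ)).PairwiseDisjoint (E f') := by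
      intro J _ J' _ hJJ'
      refine Set.disjoint_left.2 fun z hz hz' => hJJ' ?_
      exact hz.1.symm.trans hz'.1
    have hpiece : ∀ J ∈ (Finset.range T).powerset,
        P (E f J) ≤ ENNReal.ofReal (Real.exp ε) * P (E f' J) := by
      intro J hJ
      rw [Finset.mem_powerset] at hJ
      by_cases hJc : J.card ≤ c
      · refine le_trans (measure_mono fun z hz => ?_) (laplacePi_translate_le hb
          (sparseShift T f f' J) ((sum_abs_sparseShift_le hff' hJ).trans ?_) (hE f' J))
        · have hz1 : pat f z = J := hz.1
          have hmem : ∀ t < T, (t ∈ J ↔ jp f z t) := by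
            intro t ht
            simp [← hz1, pat, ht]
          have hadd : ∀ k t (ht : t < T + 1), w k (z + sparseShift T f f' J) t =
              w k z t + sparseShift T f f' J (k, ⟨t, ht⟩) := by
            intro k t ht
            simp only [w, extendZero_of_lt _ ht]
            rfl
          have hcpl := sparseState_coupling (thr := 3 * M + α) (c := c) (T := T)
            (ρ := w 0 z) (ν := w 1 z) (η := w 2 z) (ρ' := w 0 (z + sparseShift T f f' J))
            (ν' := w 1 (z + sparseShift T f f' J)) (η' := w 2 (z + sparseShift T f f' J)) hff'
            (by rw [hadd 0 0 (by omega)]; simp [sparseShift])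
            (fun t ht hj => by
              have hj' : t ∈ J := (hmem t ht).2 hj
              refine ⟨?_, ?_, ?_⟩
              · rw [hadd 0 (t + 1) (by omega)]; simp [sparseShift, hj']
              · rw [hadd 1 t (by omega)]; simp [sparseShift, hj']
              · rw [hadd 2 t (by omega)]; simp [sparseShift, hj'])
            (fun t ht hj => by
              have hj' : t ∉ J := mt (hmem t ht).1 hj
              rw [hadd 1 t (by omega)]; simp [sparseShift, hj'])
          refine ⟨?_, ?_⟩
          · refine Eq.trans ?_ hz1
            exact Finset.filter_congr fun t ht => (hcpl T le_rfl).2 t (Finset.mem_range.1 ht)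
          · have : run f' (z + sparseShift T f f' J) = run f z := by
              funext i
              show (sparseState _ _ _ _ _ _ _).1 = _
              rw [(hcpl (i + 1) i.isLt).1]
            rw [this]
            exact hz.2
        · have : (J.card : ℝ) ≤ c := by exact_mod_cast hJc
          rw [mul_div_cancel₀ _ hε.ne']
          linarith
      -- More than `c` jumps are impossible, so these pieces are empty.
      · have : E f J = ∅ := by
          refine Set.eq_empty_of_forall_notMem fun z hz => hJc ?_
          have h1 := sparseState_budget (thr := 3 * M + α) (c := c) (f := f) (ρ := w 0 z)
            (ν := w 1 z) (η := w 2 z) T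
          have h2 : (Finset.range T).filter (SparseJump (3 * M + α) c f (w 0 z) (w 1 z) (w 2 z))
            = J := hz.1
          rw [h2] at h1
          omega
        rw [this, measure_empty]
        exact zero_le
    rw [ENNReal.ofReal_zero, add_zero]
    show P {z | run f z ∈ S} ≤ _ * P {z | run f' z ∈ S}
    rw [hUnion f, hUnion f', measure_biUnion_finset hdisj fun J _ => hE f' J, Finset.mul_sum]
    exact (measure_biUnion_finset_le _ _).trans (Finset.sum_le_sum hpiece)
  · have hconc := laplacePi_concentration (ι := Fin 3 × Fin (T + 1)) hb hβ hβ1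
    have hcard : ((Fintype.card (Fin 3 × Fin (T + 1)) : ℕ) : ℝ) = 3 * (T + 1) := by
      simp
    rw [hcard, ← hMdef] at hconc
    refine one_sub_le_of_compl P hβ.le (fun z hz => ?_) hconc
    by_contra hcon
    have hz' : ∀ p, |z p| ≤ M := by
      have : ¬ ∃ p, M < |z p| := hcon
      push Not at this
      exact this
    have hwM : ∀ k t, |w k z t| ≤ M := fun k t => abs_extendZero_le hM (fun i => hz' _) t
    exact hz (sparseState_error hf hc hα hK hM (hwM 0) (hwM 1) (hwM 2))

/-! ### One step of the masked Laplace mechanism -/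

/-- Combines `r ≤ exp (r - 1)` with `exp x ≤ 1 + x + x ^ 2` for `|x| ≤ 1`. -/
lemma pow_le_one_add_sq {r : ℝ} (hr : 0 ≤ r) {n : ℕ} (h : |n * (r - 1)| ≤ 1) :
    r ^ n ≤ 1 + n * (r - 1) + (n * (r - 1)) ^ 2 := by
  have h1 : r ^ n ≤ Real.exp (n * (r - 1)) := by
    rw [Real.exp_nat_mul]
    refine pow_le_pow_left₀ hr ?_ n
    linarith [Real.add_one_le_exp (r - 1)]
  have h2 := abs_le.1 (Real.abs_exp_sub_one_sub_id_le h)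
  linarith [h2.2]

/-- Here `p₀`, `q₀` are the probabilities of discarding under the two inputs, `i`, `j` those of
releasing, and `I` is the moment on releases. To first order discarding contributes `q₀ - a * (i -
j)` and releasing `j + a * (i - j)`, which add up to 1. Both second-order errors are at most `(a *
η) ^ 2 * j`, and the factor `B⁻¹` on releases absorbs them. -/
lemma mask_moment_le {q₀ p₀ j i I η B : ℝ} {k : ℕ} (hq : 0 < q₀) (hj : 0 ≤ j)
    (hqj : q₀ + j = 1) (hpi : p₀ + i = 1) (hij : |i - j| ≤ η * j) (hpq : |p₀ - q₀| ≤ η * q₀)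
    (hη : 0 ≤ η) (hη2 : ((k + 1 : ℕ) : ℝ) * η ≤ 1 / 2)
    (hI : I ≤ j + (k + 1 : ℕ) * (i - j) + ((k + 1 : ℕ) * η) ^ 2 * j)
    (hB : 1 + 8 * ((k + 1 : ℕ) * η) ^ 2 ≤ B) :
    p₀ * (p₀ / q₀) ^ k + B⁻¹ * I ≤ 1 := by
  have ha : (1 : ℝ) ≤ (k + 1 : ℕ) := by exact_mod_cast Nat.le_add_left 1 k
  set a : ℝ := ((k + 1 : ℕ) : ℝ) with hadef
  set w := (a * η) ^ 2 with hw
  have hw0 : 0 ≤ w := sq_nonneg _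
  have hw1 : w ≤ 1 / 4 := by
    have : (a * η) ^ 2 ≤ (1 / 2) ^ 2 := pow_le_pow_left₀ (by positivity) hη2 2
    linarith
  have hη1 : η ≤ 1 / 2 := by nlinarith
  have hp : 0 ≤ p₀ := by
    have := abs_le.1 hpq
    nlinarith
  have hr1 : |p₀ / q₀ - 1| ≤ η := by
    rw [div_sub_one hq.ne', abs_div, abs_of_pos hq, div_le_iff₀ hq]
    exact hpq
  have h1 : (p₀ / q₀) ^ (k + 1) ≤ 1 + a * (p₀ / q₀ - 1) + (a * (p₀ / q₀ - 1)) ^ 2 := by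
    refine pow_le_one_add_sq (by positivity) ?_
    rw [abs_mul, abs_of_nonneg (by positivity : (0 : ℝ) ≤ ((k + 1 : ℕ) : ℝ))]
    nlinarith
  have h2 : p₀ * (p₀ / q₀) ^ k = q₀ * (p₀ / q₀) ^ (k + 1) := by
    rw [pow_succ]; field_simp
  have h3 : q₀ * (p₀ / q₀ - 1) = j - i := by
    rw [mul_sub, mul_div_cancel₀ _ hq.ne']; linarith
  -- The decisive gain: `j` instead of `q₀` on the right, since one of the two factors is the
  -- difference `j - i` of release probabilities. A step that hardly ever releases is therefore
  -- almost free.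
  have h4 : q₀ * (p₀ / q₀ - 1) ^ 2 ≤ η ^ 2 * j := by
    calc q₀ * (p₀ / q₀ - 1) ^ 2 = (q₀ * (p₀ / q₀ - 1)) * (p₀ / q₀ - 1) := by ring
      _ = (j - i) * (p₀ / q₀ - 1) := by rw [h3]
      _ ≤ |j - i| * |p₀ / q₀ - 1| := (le_abs_self _).trans_eq (abs_mul _ _)
      _ ≤ (η * j) * η := by
          rw [abs_sub_comm]
          exact mul_le_mul hij hr1 (abs_nonneg _) (by positivity)
      _ = η ^ 2 * j := by ring
  have h5 : p₀ * (p₀ / q₀) ^ k ≤ q₀ - a * (i - j) + w * j := by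
    rw [h2]
    refine (mul_le_mul_of_nonneg_left h1 hq.le).trans ?_
    have : q₀ * (1 + a * (p₀ / q₀ - 1) + (a * (p₀ / q₀ - 1)) ^ 2) =
        q₀ + a * (q₀ * (p₀ / q₀ - 1)) + a ^ 2 * (q₀ * (p₀ / q₀ - 1) ^ 2) := by ring
    rw [this, h3]
    have h6 := mul_le_mul_of_nonneg_left h4 (sq_nonneg a)
    have h7 : a ^ 2 * (η ^ 2 * j) = w * j := by rw [hw]; ring
    linarith
  have hD : |a * (i - j)| ≤ j / 2 := by
    rw [abs_mul, abs_of_nonneg (by linarith : (0 : ℝ) ≤ a)]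
    calc a * |i - j| ≤ a * (η * j) := by gcongr
      _ = a * η * j := by ring
      _ ≤ 1 / 2 * j := by gcongr
      _ = j / 2 := by ring
  have hD' := (abs_le.1 hD).1
  have hB0 : 0 < B := by linarith
  have hwj : w * j ≤ 1 / 4 * j := by gcongr
  -- Since `j + a * (i - j) - w * j ≥ j / 4`, multiplying it by `1 + 8 * w` adds at least `2 * w *
  -- j`, which turns `-w * j` into `+w * j`.
  have h8 : B⁻¹ * I ≤ j + a * (i - j) - w * j := by
    rw [inv_mul_le_iff₀ hB0]
    have h9 : (1 + 8 * w) * (j + a * (i - j) - w * j) ≤ B * (j + a * (i - j) - w * j) :=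
      mul_le_mul_of_nonneg_right hB (by linarith)
    have h10 : 8 * w * (j / 4) ≤ 8 * w * (j + a * (i - j) - w * j) :=
      mul_le_mul_of_nonneg_left (by linarith) (by positivity)
    linarith
  linarith

lemma integrable_laplacePDF {b : ℝ} (hb : 0 < b) : Integrable (laplacePDF b) := by
  have := isProbabilityMeasure_laplace hb
  refine (lintegral_ofReal_ne_top_iff_integrable (measurable_laplacePDF b).aestronglyMeasurable
    (ae_of_all _ fun x => (laplacePDF_pos hb x).le)).1 ?_
  have h : laplace b Set.univ = 1 := measure_univ
  rw [laplace, withDensity_apply _ MeasurableSet.univ, setLIntegral_univ] at h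
  rw [h]
  exact ENNReal.one_ne_top

lemma integral_laplacePDF {b : ℝ} (hb : 0 < b) : ∫ x, laplacePDF b x = 1 := by
  have := isProbabilityMeasure_laplace hb
  have h : laplace b Set.univ = 1 := measure_univ
  rw [laplace, withDensity_apply _ MeasurableSet.univ, setLIntegral_univ,
    ← ofReal_integral_eq_lintegral_ofReal (integrable_laplacePDF hb)
      (ae_of_all _ fun x => (laplacePDF_pos hb x).le)] at h
  exact ENNReal.ofReal_eq_one.1 h

lemma abs_laplacePDF_sub_le {b u u' : ℝ} (hb : 1 ≤ b) (hu : |u - u'| ≤ 1) (y : ℝ) :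
    |laplacePDF b (y - u) - laplacePDF b (y - u')| ≤ 2 / b * laplacePDF b (y - u') := by
  have hb0 : 0 < b := by linarith
  have h1 := laplacePDF_sub b (u - u') (y - u')
  rw [show y - u' - (u - u') = y - u by ring] at h1
  set x := (|y - u'| - |y - u|) / b with hx
  have hx1 : |x| ≤ 1 / b := by
    rw [hx, abs_div, abs_of_pos hb0]
    gcongr
    refine (abs_abs_sub_abs_le_abs_sub _ _).trans ?_
    rwa [show y - u' - (y - u) = u - u' by ring]
  have hx2 : |x| ≤ 1 := hx1.trans (by rw [div_le_one hb0]; exact hb)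
  have h2 : laplacePDF b (y - u) = laplacePDF b (y - u') * Real.exp x := by
    rw [← h1]
  rw [h2, ← mul_sub_one, abs_mul, abs_of_pos (laplacePDF_pos hb0 _), mul_comm]
  gcongr
  · exact (laplacePDF_pos hb0 _).le
  · refine (Real.abs_exp_sub_one_le hx2).trans ?_
    calc 2 * |x| ≤ 2 * (1 / b) := by gcongr
      _ = 2 / b := by ring

/-- One step of the masked Laplace mechanism: a noisy count `y` further than `thr` away from the
current output `s.1` becomes the new output, while the budget `s.2` lasts; otherwise it is
discarded. -/
noncomputable def maskStep (thr : ℝ) (s : ℝ × ℕ) (y : ℝ) : ℝ × ℕ :=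
  open Classical in if 0 < s.2 ∧ thr < |y - s.1| then (y, s.2 - 1) else s

lemma lintegral_laplace_shift {b : ℝ} (u : ℝ) (F : ℝ → ℝ≥0∞) :
    ∫⁻ a, F (u + a) ∂laplace b = ∫⁻ y, ENNReal.ofReal (laplacePDF b (y - u)) * F y := by
  rw [laplace, lintegral_withDensity_eq_lintegral_mul_non_measurable _
    (measurable_laplacePDF b).ennreal_ofReal (ae_of_all _ fun _ => ENNReal.ofReal_lt_top),
    ← lintegral_add_right_eq_self (fun y => ENNReal.ofReal (laplacePDF b (y - u)) * F y) u]
  simp [add_comm u]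

lemma lintegral_maskStep {b thr u : ℝ} (hb : 0 < b) {s : ℝ × ℕ} (hs : 0 < s.2)
    (H : ℝ × ℕ → ℝ≥0∞) {N : Set ℝ} (hN : N = {y | |y - s.1| ≤ thr}) :
    ∫⁻ a, H (maskStep thr s (u + a)) ∂laplace b =
      ENNReal.ofReal (∫ y in N, laplacePDF b (y - u)) * H s +
        ∫⁻ y in Nᶜ, ENNReal.ofReal (laplacePDF b (y - u)) * H (y, s.2 - 1) := by
  have hNm : MeasurableSet N := by
    rw [hN]; exact measurableSet_le (by fun_prop) (by fun_prop)
  have hint : Integrable fun y => laplacePDF b (y - u) := (integrable_laplacePDF hb).comp_sub_right u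
  have hmeas : Measurable fun y => ENNReal.ofReal (laplacePDF b (y - u)) :=
    ((measurable_laplacePDF b).comp (measurable_id.sub_const u)).ennreal_ofReal
  rw [lintegral_laplace_shift u fun y => H (maskStep thr s y), ← lintegral_add_compl _ hNm,
    ofReal_integral_eq_lintegral_ofReal hint.integrableOn
      (ae_of_all _ fun y => (laplacePDF_pos hb _).le), ← lintegral_mul_const _ hmeas]
  congr 1
  · refine setLIntegral_congr_fun hNm fun y hy => ?_
    have : maskStep thr s y = s := by
      rw [hN] at hy
      exact if_neg fun h => not_lt.2 hy h.2
    simp only [this]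
  · refine setLIntegral_congr_fun hNm.compl fun y hy => ?_
    have : maskStep thr s y = (y, s.2 - 1) := by
      rw [hN] at hy
      exact if_pos ⟨hs, not_le.1 hy⟩
    simp only [this]

/-- Using a bound at `τ * (q / p)` instead of `τ` changes the weight `p` of the main term into `q`,
at the price of a likelihood-ratio moment in the remainder. -/
lemma ofReal_mul_rescale {p q τ : ℝ} (hp : 0 < p) (hq : 0 < q) (hτ : 0 < τ) {k : ℕ} (x : ℝ≥0∞)
    (c : ℝ) :
    ENNReal.ofReal p * (ENNReal.ofReal (τ * (q / p)) * x +
        ENNReal.ofReal ((τ * (q / p))⁻¹ ^ k * c)) =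
      ENNReal.ofReal τ * (ENNReal.ofReal q * x) +
        ENNReal.ofReal (p * (p / q) ^ k * (τ⁻¹ ^ k * c)) := by
  have h1 : p * (τ * (q / p)) = τ * q := by field_simp
  have h2 : p * ((τ * (q / p))⁻¹ ^ k * c) = p * (p / q) ^ k * (τ⁻¹ ^ k * c) := by
    rw [mul_inv, inv_div, mul_pow]; ring
  rw [mul_add, ← mul_assoc, ← mul_assoc, ← ENNReal.ofReal_mul hp.le, ← ENNReal.ofReal_mul hτ.le,
    ← ENNReal.ofReal_mul hp.le, h1, h2]

/-- The hypothesis is applied with `τ` rescaled by the likelihood ratio of what is observed: `q₀ /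
p₀` for a discarded value, treated as a single atom, and `q y / p y` for a released `y`. The
remainders then form the moment bounded in `mask_moment_le`. -/
lemma mask_step_le {b thr u u' τ B : ℝ} {k : ℕ} (hthr : 0 < thr) (hu : |u - u'| ≤ 1)
    (hb : 4 * ((k + 1 : ℕ) : ℝ) ≤ b) (hB : 1 + 8 * (((k + 1 : ℕ) : ℝ) * (2 / b)) ^ 2 ≤ B) (hτ : 0 < τ)
    {H H' : ℝ × ℕ → ℝ≥0∞}
    (hH : ∀ s, ∀ τ > 0, H s ≤ ENNReal.ofReal τ * H' s + ENNReal.ofReal (τ⁻¹ ^ k * B ^ s.2))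
    (s : ℝ × ℕ) :
    ∫⁻ a, H (maskStep thr s (u + a)) ∂laplace b ≤
      ENNReal.ofReal τ * ∫⁻ a, H' (maskStep thr s (u' + a)) ∂laplace b +
        ENNReal.ofReal (τ⁻¹ ^ k * B ^ s.2) := by
  have ha1 : (1 : ℝ) ≤ (k + 1 : ℕ) := by exact_mod_cast Nat.le_add_left 1 k
  have hb1 : 1 ≤ b := by linarith
  have hb0 : 0 < b := by linarith
  have hB0 : 0 < B := lt_of_lt_of_le (by positivity) hB
  -- With no budget left the state is frozen and the step reveals nothing.
  rcases Nat.eq_zero_or_pos s.2 with hs0 | hs0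
  · have : ∀ y, maskStep thr s y = s := fun y => if_neg fun h => by omega
    have hprob := isProbabilityMeasure_laplace hb0
    simpa [this] using hH s τ hτ
  set N : Set ℝ := {y | |y - s.1| ≤ thr} with hN
  rw [lintegral_maskStep hb0 hs0 H hN, lintegral_maskStep hb0 hs0 H' hN]
  have hNm : MeasurableSet N := measurableSet_le (by fun_prop) (by fun_prop)
  set p : ℝ → ℝ := fun y => laplacePDF b (y - u) with hp
  set q : ℝ → ℝ := fun y => laplacePDF b (y - u') with hq
  have hppos : ∀ y, 0 < p y := fun y => laplacePDF_pos hb0 _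
  have hqpos : ∀ y, 0 < q y := fun y => laplacePDF_pos hb0 _
  have hpint : Integrable p := (integrable_laplacePDF hb0).comp_sub_right u
  have hqint : Integrable q := (integrable_laplacePDF hb0).comp_sub_right u'
  have hpm : Measurable p := (measurable_laplacePDF b).comp (measurable_id.sub_const u)
  have hqm : Measurable q := (measurable_laplacePDF b).comp (measurable_id.sub_const u')
  have hpq : ∀ y, |p y - q y| ≤ 2 / b * q y := abs_laplacePDF_sub_le hb1 hu
  have hptot : (∫ y in N, p y) + ∫ y in Nᶜ, p y = 1 := by
    rw [integral_add_compl hNm hpint, hp, integral_sub_right_eq_self (laplacePDF b),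
      integral_laplacePDF hb0]
  have hqtot : (∫ y in N, q y) + ∫ y in Nᶜ, q y = 1 := by
    rw [integral_add_compl hNm hqint, hq, integral_sub_right_eq_self (laplacePDF b),
      integral_laplacePDF hb0]
  have hset : ∀ A : Set ℝ, |(∫ y in A, p y) - ∫ y in A, q y| ≤ 2 / b * ∫ y in A, q y := by
    intro A
    rw [← integral_sub hpint.integrableOn hqint.integrableOn, ← integral_const_mul]
    exact (abs_integral_le_integral_abs).trans (integral_mono (hpint.sub hqint).integrableOn.abs
      (hqint.const_mul _).integrableOn fun y => hpq y)
  -- Positivity of `thr` makes the discarding interval non-degenerate, so that the ratios of `p₀`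
  -- and `q₀` make sense.
  have hNpos : ∀ g : ℝ → ℝ, (∀ y, 0 < g y) → Integrable g → 0 < ∫ y in N, g y := by
    intro g hg hgi
    rw [setIntegral_pos_iff_support_of_nonneg_ae (ae_of_all _ fun y => (hg y).le) hgi.integrableOn]
    have h1 : Function.support g = Set.univ := Set.eq_univ_of_forall fun y => (hg y).ne'
    have h2 : N = Set.Icc (s.1 - thr) (s.1 + thr) := by
      ext y
      rw [Set.mem_Icc]
      show |y - s.1| ≤ thr ↔ _
      rw [abs_le]
      constructor <;> rintro ⟨h, h'⟩ <;> constructor <;> linarith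
    rw [h1, Set.univ_inter, h2, Real.volume_Icc, ENNReal.ofReal_pos]
    linarith
  have hp0 := hNpos p hppos hpint
  have hq0 := hNpos q hqpos hqint
  set p₀ := ∫ y in N, p y
  set q₀ := ∫ y in N, q y
  set I := ∫ y in Nᶜ, p y * (p y / q y) ^ k with hI
  have hη2 : ((k + 1 : ℕ) : ℝ) * (2 / b) ≤ 1 / 2 := by
    rw [mul_div_assoc', div_le_iff₀ hb0]
    linarith
  have hIpt : ∀ y, p y * (p y / q y) ^ k ≤
      q y + (k + 1 : ℕ) * (p y - q y) + ((k + 1 : ℕ) * (2 / b)) ^ 2 * q y := by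
    intro y
    have hqy := hqpos y
    have h1 : p y * (p y / q y) ^ k = q y * (p y / q y) ^ (k + 1) := by
      rw [pow_succ]; field_simp
    have h2 : |p y / q y - 1| ≤ 2 / b := by
      rw [div_sub_one hqy.ne', abs_div, abs_of_pos hqy, div_le_iff₀ hqy]
      exact hpq y
    have h3 : |((k + 1 : ℕ) : ℝ) * (p y / q y - 1)| ≤ (k + 1 : ℕ) * (2 / b) := by
      rw [abs_mul, abs_of_nonneg (by linarith : (0 : ℝ) ≤ ((k + 1 : ℕ) : ℝ))]
      gcongr
    have h4 := pow_le_one_add_sq (div_nonneg (hppos y).le hqy.le) (h3.trans (by linarith))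
    have h5 : (((k + 1 : ℕ) : ℝ) * (p y / q y - 1)) ^ 2 ≤ ((k + 1 : ℕ) * (2 / b)) ^ 2 :=
      sq_le_sq.2 (h3.trans (le_abs_self _))
    rw [h1]
    calc q y * (p y / q y) ^ (k + 1)
        ≤ q y * (1 + (k + 1 : ℕ) * (p y / q y - 1) + ((k + 1 : ℕ) * (2 / b)) ^ 2) := by
          gcongr; linarith
      _ = _ := by field_simp
  have hmaj : Integrable fun y =>
      q y + (k + 1 : ℕ) * (p y - q y) + ((k + 1 : ℕ) * (2 / b)) ^ 2 * q y :=
    (hqint.add ((hpint.sub hqint).const_mul _)).add (hqint.const_mul _)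
  have hImeas : Measurable fun y => p y * (p y / q y) ^ k := hpm.mul ((hpm.div hqm).pow_const k)
  have hInonneg : ∀ y, 0 ≤ p y * (p y / q y) ^ k := fun y => by
    have := hppos y
    have := hqpos y
    positivity
  have hIint : Integrable fun y => p y * (p y / q y) ^ k := by
    refine hmaj.mono' hImeas.aestronglyMeasurable (ae_of_all _ fun y => ?_)
    rw [Real.norm_of_nonneg (hInonneg y)]
    exact hIpt y
  have hIle : I ≤ (∫ y in Nᶜ, q y) + (k + 1 : ℕ) * ((∫ y in Nᶜ, p y) - ∫ y in Nᶜ, q y) +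
      ((k + 1 : ℕ) * (2 / b)) ^ 2 * ∫ y in Nᶜ, q y := by
    refine (integral_mono hIint.integrableOn hmaj.integrableOn hIpt).trans_eq ?_
    have h1 : Integrable (fun y => ((k + 1 : ℕ) : ℝ) * (p y - q y)) :=
      (hpint.sub hqint).const_mul _
    have h2 : Integrable (fun y => q y + ((k + 1 : ℕ) : ℝ) * (p y - q y)) := hqint.add h1
    rw [integral_add h2.integrableOn (hqint.const_mul _).integrableOn,
      integral_add hqint.integrableOn h1.integrableOn, integral_const_mul, integral_const_mul,
      integral_sub hpint.integrableOn hqint.integrableOn]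
  have hmoment := mask_moment_le (k := k) hq0
    (setIntegral_nonneg hNm.compl fun y _ => (hqpos y).le) hqtot hptot (hset _) (hset _)
    (by positivity) hη2 hIle hB
  have hbudget : ENNReal.ofReal (p₀ * (p₀ / q₀) ^ k * (τ⁻¹ ^ k * B ^ s.2)) +
      -- A release lowers the budget by one; this is the source of `B⁻¹` in the moment inequality.
      ENNReal.ofReal (I * (τ⁻¹ ^ k * B ^ (s.2 - 1))) ≤ ENNReal.ofReal (τ⁻¹ ^ k * B ^ s.2) := by
    have hI0 : 0 ≤ I := setIntegral_nonneg hNm.compl fun y _ => hInonneg y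
    rw [← ENNReal.ofReal_add (by positivity) (by positivity)]
    apply ENNReal.ofReal_le_ofReal
    have h1 : B ^ s.2 = B ^ (s.2 - 1) * B := by rw [← pow_succ, Nat.sub_add_cancel hs0]
    have h2 : B ^ (s.2 - 1) = B ^ s.2 * B⁻¹ := by rw [h1]; field_simp
    rw [h2]
    calc _ = (p₀ * (p₀ / q₀) ^ k + B⁻¹ * I) * (τ⁻¹ ^ k * B ^ s.2) := by ring
      _ ≤ 1 * (τ⁻¹ ^ k * B ^ s.2) := by gcongr
      _ = _ := one_mul _
  have hstay : ENNReal.ofReal p₀ * H s ≤ ENNReal.ofReal τ * (ENNReal.ofReal q₀ * H' s) +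
      ENNReal.ofReal (p₀ * (p₀ / q₀) ^ k * (τ⁻¹ ^ k * B ^ s.2)) := by
    exact (mul_le_mul_right (hH s (τ * (q₀ / p₀)) (by positivity)) _).trans_eq
      (ofReal_mul_rescale hp0 hq0 hτ _ _)
  have hjump : ∫⁻ y in Nᶜ, ENNReal.ofReal (p y) * H (y, s.2 - 1) ≤
      ENNReal.ofReal τ * (∫⁻ y in Nᶜ, ENNReal.ofReal (q y) * H' (y, s.2 - 1)) +
      ENNReal.ofReal (I * (τ⁻¹ ^ k * B ^ (s.2 - 1))) := by
    rw [hI, ← integral_mul_const, ofReal_integral_eq_lintegral_ofReal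
      (hIint.mul_const _).integrableOn (ae_of_all _ fun y =>
        mul_nonneg (hInonneg y) (by positivity)), ← lintegral_const_mul' _ _ ENNReal.ofReal_ne_top,
      ← lintegral_add_right _ (hImeas.mul_const _).ennreal_ofReal]
    refine lintegral_mono fun y => ?_
    have hpy := hppos y
    have hqy := hqpos y
    exact (mul_le_mul_right (hH (y, s.2 - 1) (τ * (q y / p y)) (by positivity)) _).trans_eq
      (ofReal_mul_rescale hpy hqy hτ _ _)
  calc _ ≤ (ENNReal.ofReal τ * (ENNReal.ofReal q₀ * H' s) +
        ENNReal.ofReal (p₀ * (p₀ / q₀) ^ k * (τ⁻¹ ^ k * B ^ s.2))) +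
      (ENNReal.ofReal τ * (∫⁻ y in Nᶜ, ENNReal.ofReal (q y) * H' (y, s.2 - 1)) +
        ENNReal.ofReal (I * (τ⁻¹ ^ k * B ^ (s.2 - 1)))) := add_le_add hstay hjump
    _ = ENNReal.ofReal τ * (ENNReal.ofReal q₀ * H' s +
          ∫⁻ y in Nᶜ, ENNReal.ofReal (q y) * H' (y, s.2 - 1)) +
        (ENNReal.ofReal (p₀ * (p₀ / q₀) ^ k * (τ⁻¹ ^ k * B ^ s.2)) +
          ENNReal.ofReal (I * (τ⁻¹ ^ k * B ^ (s.2 - 1)))) := by ring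
    _ ≤ _ := add_le_add le_rfl hbudget

/-! ### The masked Laplace mechanism -/

lemma laplacePi_succ_apply {n : ℕ} {b : ℝ} (hb : 0 < b) {A : Set (Fin (n + 1) → ℝ)}
    (hA : MeasurableSet A) :
    laplacePi (Fin (n + 1)) b A =
      ∫⁻ a, laplacePi (Fin n) b {z | (Fin.cons a z : Fin (n + 1) → ℝ) ∈ A} ∂laplace b := by
  have := isProbabilityMeasure_laplace hb
  have hmp := (measurePreserving_piFinSuccAbove (fun _ : Fin (n + 1) => laplace b) 0).symm
  have h1 := hmp.measure_preimage hA.nullMeasurableSet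
  unfold laplacePi
  rw [← h1, Measure.prod_apply (hmp.measurable hA)]
  refine lintegral_congr fun a => ?_
  congr 1
  ext z
  simp only [Set.mem_preimage, MeasurableEquiv.piFinSuccAbove_symm_apply, Fin.insertNthEquiv,
    Equiv.coe_fn_mk, Fin.insertNth_zero]
  rfl

/-- The state (output, remaining budget) of the masked Laplace mechanism with initial state `s`. -/
noncomputable def maskState (thr : ℝ) (f z : ℕ → ℝ) (s : ℝ × ℕ) : ℕ → ℝ × ℕ
  | 0 => s
  | t + 1 => maskStep thr (maskState thr f z s t) (f (t + 1) + z t)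

lemma maskState_causal {thr : ℝ} {f f' z : ℕ → ℝ} {s : ℝ × ℕ} {t : ℕ}
    (h : ∀ i ≤ t, f i = f' i) : maskState thr f z s t = maskState thr f' z s t := by
  induction t with
  | zero => rfl
  | succ t ih => rw [maskState, maskState, ih fun i hi => h i (by omega), h (t + 1) le_rfl]

/-- Peels off the first step instead of the last, as the induction over time conditions on the first
noise variable. -/
lemma maskState_succ' (thr : ℝ) (f z : ℕ → ℝ) (s : ℝ × ℕ) (t : ℕ) :
    maskState thr f z s (t + 1) = maskState thr (fun i => f (i + 1)) (fun i => z (i + 1))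
      (maskStep thr s (f 1 + z 0)) t := by
  induction t with
  | zero => rfl
  | succ t ih => rw [maskState, ih, maskState]

lemma measurable_maskState {Ω : Type*} [MeasurableSpace Ω] (thr : ℝ) (f : ℕ → ℝ) {z : Ω → ℕ → ℝ}
    (hz : ∀ t, Measurable fun ω => z ω t) (s : ℝ × ℕ) (t : ℕ) :
    Measurable fun ω => maskState thr f (z ω) s t := by
  induction t with
  | zero => exact measurable_const
  | succ t ih =>
    have hy : Measurable fun ω => f (t + 1) + z ω t := (hz t).const_add _
    refine Measurable.ite ?_ (hy.prodMk
      ((measurable_of_countable fun k : ℕ => k - 1).comp ih.snd)) ih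
    exact (measurableSet_lt measurable_const ih.snd).inter
      (measurableSet_lt measurable_const (hy.sub ih.fst).abs)

lemma extendZero_cons_zero {n : ℕ} (a : ℝ) (z : Fin n → ℝ) :
    extendZero (Fin.cons a z : Fin (n + 1) → ℝ) 0 = a := by
  rw [extendZero_of_lt _ n.succ_pos]
  rfl

lemma extendZero_cons_succ {n : ℕ} (a : ℝ) (z : Fin n → ℝ) (t : ℕ) :
    extendZero (Fin.cons a z : Fin (n + 1) → ℝ) (t + 1) = extendZero z t := by
  by_cases h : t < n
  · rw [extendZero_of_lt _ (Nat.succ_lt_succ h), extendZero_of_lt _ h]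
    rfl
  · simp [extendZero, h]

/-- The output of the masked Laplace mechanism in the first `n` time steps. -/
noncomputable def maskRun (thr : ℝ) (n : ℕ) (f : ℕ → ℝ) (s : ℝ × ℕ) (z : Fin n → ℝ) : Fin n → ℝ :=
  fun i => (maskState thr f (extendZero z) s (i + 1)).1

lemma measurable_maskRun (thr : ℝ) (n : ℕ) (f : ℕ → ℝ) (s : ℝ × ℕ) :
    Measurable (maskRun thr n f s) :=
  measurable_pi_lambda _ fun i =>
    (measurable_maskState thr f (measurable_extendZero n) s (i + 1)).fst

lemma maskRun_cons (thr : ℝ) (n : ℕ) (f : ℕ → ℝ) (s : ℝ × ℕ) (a : ℝ) (z : Fin n → ℝ) :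
    maskRun thr (n + 1) f s (Fin.cons a z) = Fin.cons (maskStep thr s (f 1 + a)).1
      (maskRun thr n (fun i => f (i + 1)) (maskStep thr s (f 1 + a)) z) := by
  have h : ∀ t, maskState thr f (extendZero (Fin.cons a z : Fin (n + 1) → ℝ)) s (t + 1) =
      maskState thr (fun i => f (i + 1)) (extendZero z) (maskStep thr s (f 1 + a)) t := by
    intro t
    rw [maskState_succ', extendZero_cons_zero]
    simp only [extendZero_cons_succ]
  funext i
  refine Fin.cases ?_ (fun i => ?_) i
  · simp only [maskRun, h]
    rfl
  · simp only [maskRun, h, Fin.cons_succ, Fin.val_succ]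

/-- A privacy bound with a free parameter `τ`, proved by induction over the time steps. -/
lemma maskRun_le {b thr B : ℝ} {k : ℕ} (hthr : 0 < thr) (hb : 4 * ((k + 1 : ℕ) : ℝ) ≤ b)
    (hB : 1 + 8 * (((k + 1 : ℕ) : ℝ) * (2 / b)) ^ 2 ≤ B) (n : ℕ) :
    ∀ (f f' : ℕ → ℝ), (∀ t, |f t - f' t| ≤ 1) → ∀ S : Set (Fin n → ℝ), MeasurableSet S →
      ∀ (s : ℝ × ℕ), ∀ τ > 0, laplacePi (Fin n) b {z | maskRun thr n f s z ∈ S} ≤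
        ENNReal.ofReal τ * laplacePi (Fin n) b {z | maskRun thr n f' s z ∈ S} +
          ENNReal.ofReal (τ⁻¹ ^ k * B ^ s.2) := by
  have hb0 : 0 < b := lt_of_lt_of_le (by positivity) hb
  have hB1 : 1 ≤ B := by
    have : 0 ≤ (((k + 1 : ℕ) : ℝ) * (2 / b)) ^ 2 := sq_nonneg _
    linarith
  induction n with
  | zero =>
    intro f f' _ S _ s τ hτ
    have hprob := isProbabilityMeasure_laplacePi (Fin 0) hb0
    have hrun : maskRun thr 0 f s = maskRun thr 0 f' s := funext fun z => Subsingleton.elim _ _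
    rw [hrun]
    -- With no outputs both probabilities coincide: for `τ ≥ 1` the main term suffices, and for `τ ≤
    -- 1` the remainder is at least 1.
    rcases le_total 1 τ with h | h
    · exact le_add_right (le_mul_of_one_le_left' (ENNReal.one_le_ofReal.2 h))
    · refine le_add_left (prob_le_one.trans (ENNReal.one_le_ofReal.2 ?_))
      exact one_le_mul_of_one_le_of_one_le (one_le_pow₀ ((one_le_inv₀ hτ).2 h)) (one_le_pow₀ hB1)
  | succ n ih =>
    intro f f' hff' S hS s τ hτ
    -- The probability of `S` given the state after the first step. The first output is the first
    -- component of that state, so it can be prepended to the later ones.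
    let H : (ℕ → ℝ) → ℝ × ℕ → ℝ≥0∞ := fun f s' => laplacePi (Fin n) b
      {z | maskRun thr n (fun i => f (i + 1)) s' z ∈
        {w : Fin n → ℝ | (Fin.cons s'.1 w : Fin (n + 1) → ℝ) ∈ S}}
    have hpeel : ∀ f : ℕ → ℝ, laplacePi (Fin (n + 1)) b {z | maskRun thr (n + 1) f s z ∈ S} =
        ∫⁻ a, H f (maskStep thr s (f 1 + a)) ∂laplace b := by
      intro f
      refine (laplacePi_succ_apply hb0 (measurable_maskRun thr (n + 1) f s hS)).trans ?_
      refine lintegral_congr fun a => ?_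
      congr 1
      ext z
      show maskRun thr (n + 1) f s (Fin.cons a z) ∈ S ↔ _
      rw [maskRun_cons]
      rfl
    rw [hpeel f, hpeel f']
    refine mask_step_le (H := H f) (H' := H f') hthr (hff' 1) hb hB hτ (fun s' τ' hτ' => ?_) s
    have hcons : Measurable fun w : Fin n → ℝ => (Fin.cons s'.1 w : Fin (n + 1) → ℝ) := by
      refine measurable_pi_lambda _ fun i => ?_
      refine Fin.cases ?_ (fun i => ?_) i
      · exact measurable_const
      · exact measurable_pi_apply i
    exact ih _ _ (fun t => hff' (t + 1)) _ (hcons hS) s' τ' hτ'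

/-- One noise variable serves both as test and as released value. With threshold `2 * M + α`, a
release certifies a true distance above `M + α`, and a discarded value one of at most `3 * M + α`.
-/
lemma maskState_error {d T K c : ℕ} {M α : ℝ} {f z : ℕ → ℝ} (hf : IsCountSequence d T K f)
    (hc : 0 < c) (hα : 0 ≤ α) (hK : (K : ℝ) ≤ c * α) (hM : 0 ≤ M) (hz : ∀ t, |z t| ≤ M) :
    ∀ t < T, |(maskState (2 * M + α) f z (0, c) (t + 1)).1 - f (t + 1)| ≤ 3 * M + α := by
  refine lazy_update_error (o := fun t => (maskState (2 * M + α) f z (0, c) t).1)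
    (m := fun t => (maskState (2 * M + α) f z (0, c) t).2) (M := M) (α := α) hf hc hM
    (by linarith) hK rfl rfl fun t _ => ?_
  set s := maskState (2 * M + α) f z (0, c) t with hs
  have htri : |f (t + 1) + z t - s.1| ≤ |f (t + 1) - s.1| + |z t| := by
    rw [add_sub_right_comm]; exact abs_add_le _ _
  have htri' : |f (t + 1) - s.1| ≤ |f (t + 1) + z t - s.1| + |z t| := by
    have := abs_sub (f (t + 1) + z t - s.1) (z t)
    rwa [show f (t + 1) + z t - s.1 - z t = f (t + 1) - s.1 by ring] at this
  have h1 := hz t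
  simp only [maskState, ← hs]
  by_cases hj : 0 < s.2 ∧ 2 * M + α < |f (t + 1) + z t - s.1|
  · left
    have hstep : maskStep (2 * M + α) s (f (t + 1) + z t) = (f (t + 1) + z t, s.2 - 1) := if_pos hj
    rw [hstep]
    refine ⟨hj.1, ?_, by simpa using h1, by linarith [hj.2]⟩
    have := hj.1
    simp only
    omega
  · right
    have hstep : maskStep (2 * M + α) s (f (t + 1) + z t) = s := if_neg hj
    rw [hstep]
    refine ⟨rfl, rfl, fun hb => ?_⟩
    have h3 : ¬ _ := fun h => hj ⟨hb, h⟩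
    linarith [not_lt.1 h3]

/-- The masked Laplace mechanism is private, and accurate if the budget `c` suffices. -/
lemma achievable_mask {d T K c k : ℕ} {ε β α b : ℝ} (hT : 0 < T) (hβ : 0 < β)
    (hβ1 : β < 1) (hc : 0 < c) (hα : 0 ≤ α) (hK : (K : ℝ) ≤ c * α)
    (hb : 4 * ((k + 1 : ℕ) : ℝ) ≤ b) :
    Achievable d T K ε (Real.exp (8 * (((k + 1 : ℕ) : ℝ) * (2 / b)) ^ 2 * c - ε * k)) β
      (3 * (b * Real.log (T / β)) + α) := by
  have hb0 : 0 < b := lt_of_lt_of_le (by positivity) hb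
  have hT1 : (1 : ℝ) ≤ T := by exact_mod_cast hT
  have hlog : 0 < Real.log (T / β) := by
    apply Real.log_pos
    rw [lt_div_iff₀ hβ]
    linarith
  set M := b * Real.log (T / β) with hMdef
  have hM : 0 < M := mul_pos hb0 hlog
  have : Nonempty (Fin T) := ⟨⟨0, hT⟩⟩
  have hprob := isProbabilityMeasure_laplacePi (Fin T) hb0
  set w := (((k + 1 : ℕ) : ℝ) * (2 / b)) ^ 2 with hw
  refine achievable_of_sequence (laplacePi (Fin T) b)
    (fun f z t => (maskState (2 * M + α) f (extendZero z) (0, c) t).1)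
    (fun f t => (measurable_maskState _ f (measurable_extendZero T) _ t).fst)
    (fun f f' z t h => by simp only [maskState_causal h]) (fun f f' hff' S hS => ?_)
    (fun f hf => ?_)
  -- Take `τ = exp ε` and `B = exp (8 * w)`; the remainder with the full budget `c` is then the
  -- claimed `δ`.
  · have h := maskRun_le (thr := 2 * M + α) (B := Real.exp (8 * w)) (by linarith) hb
      (by linarith [Real.add_one_le_exp (8 * w)]) T f f' hff' S hS (0, c) (Real.exp ε)
      (Real.exp_pos _)
    have hδ : (Real.exp ε)⁻¹ ^ k * Real.exp (8 * w) ^ c = Real.exp (8 * w * c - ε * k) := by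
      rw [← Real.exp_neg, ← Real.exp_nat_mul, ← Real.exp_nat_mul, ← Real.exp_add]
      congr 1
      ring
    rw [hδ] at h
    exact h
  · have hconc := laplacePi_concentration (ι := Fin T) hb0 hβ hβ1
    rw [Fintype.card_fin, ← hMdef] at hconc
    refine one_sub_le_of_compl _ hβ.le (fun z hz => ?_) hconc
    by_contra hcon
    have hz' : ∀ i, |z i| ≤ M := by
      have : ¬ ∃ i, M < |z i| := hcon
      push Not at this
      exact this
    exact hz (maskState_error hf hc hα hK hM.le (abs_extendZero_le hM.le hz'))

/-! ### Choice of the parameters -/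

lemma log_mul_div_le {a T β : ℝ} {n : ℕ} (ha : 0 < a) (han : a ≤ 2 ^ n) (hT : 0 < T) (hβ : 0 < β)
    (h : Real.log 2 ≤ Real.log (T / β)) : Real.log (a * (T / β)) ≤ (n + 1) * Real.log (T / β) := by
  rw [Real.log_mul ha.ne' (by positivity)]
  have h1 : Real.log a ≤ n * Real.log 2 := by
    rw [← Real.log_pow]
    exact Real.log_le_log ha han
  have h2 : (n : ℝ) * Real.log 2 ≤ n * Real.log (T / β) := by gcongr
  linarith

lemma log_div_pos {T : ℕ} {β : ℝ} (hT : 0 < T) (hβ : 0 < β) (hβ1 : β < 1) :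
    0 < Real.log (T / β) := by
  have : (1 : ℝ) ≤ T := by exact_mod_cast hT
  apply Real.log_pos
  rw [lt_div_iff₀ hβ]
  linarith

/-- Constants inside the logarithm cannot be absorbed when `log (T / β)` is tiny. This happens only
for a single time step, where plain Laplace noise is good enough. -/
lemma eq_one_of_log_div_lt {T : ℕ} {β : ℝ} (hT : 0 < T) (hβ : 0 < β) (hβ1 : β < 1)
    (h : Real.log (T / β) < Real.log 2) : T = 1 := by
  have hT' : (0 : ℝ) < T := by exact_mod_cast hT
  have h1 : (T : ℝ) / β < 2 := (Real.log_lt_log_iff (by positivity) (by norm_num)).1 h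
  rw [div_lt_iff₀ hβ] at h1
  have : (T : ℝ) < 2 := by linarith
  have : T < 2 := by exact_mod_cast this
  omega

/-- The budget is `K / A` rounded up; as `A ≤ K`, rounding costs at most a factor 2. -/
lemma exists_budget {K A : ℝ} (hA : 0 < A) (hAK : A ≤ K) :
    ∃ c : ℕ, 0 < c ∧ K ≤ c * A ∧ c * A ≤ 2 * K := by
  refine ⟨⌈K / A⌉₊, Nat.ceil_pos.2 (div_pos (hA.trans_le hAK) hA), ?_, ?_⟩
  · exact (div_le_iff₀ hA).1 (Nat.le_ceil _)
  · have h1 := (Nat.ceil_lt_add_one (div_nonneg (hA.le.trans hAK) hA.le)).le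
    calc (⌈K / A⌉₊ : ℝ) * A ≤ (K / A + 1) * A := by gcongr
      _ = K + A := by field_simp
      _ ≤ 2 * K := by linarith

lemma achievable_sparse_of_log {d T K c : ℕ} {ε β α : ℝ} (hT : 0 < T) (hε : 0 < ε) (hβ : 0 < β)
    (hβ1 : β < 1) (hc : 0 < c) (hα : 0 ≤ α) (hK : (K : ℝ) ≤ c * α)
    (hlog : Real.log 2 ≤ Real.log (T / β)) :
    Achievable d T K ε 0 β (100 * (ε⁻¹ * c * Real.log (T / β)) + α) := by
  have hT' : (1 : ℝ) ≤ T := by exact_mod_cast hT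
  have h1 : Real.log (3 * (T + 1) / β) ≤ 4 * Real.log (T / β) := by
    -- `3 * (T + 1) ≤ 6 * T` and `6 ≤ 2 ^ 3`.
    have h2 := log_mul_div_le (a := 6) (n := 3) (by norm_num) (by norm_num)
      (by linarith : (0 : ℝ) < T) hβ hlog
    have h3 : Real.log (3 * (T + 1) / β) ≤ Real.log (6 * (T / β)) := by
      refine Real.log_le_log (by positivity) ?_
      rw [mul_div_assoc']
      exact div_le_div_of_nonneg_right (by linarith) hβ.le
    refine h3.trans (h2.trans_eq ?_)
    norm_num
  refine (achievable_sparse hε hβ hβ1 hc hα hK).mono le_rfl ?_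
  have h4 : 5 * (c : ℝ) / ε * Real.log (3 * (T + 1) / β) ≤ 5 * c / ε * (4 * Real.log (T / β)) := by
    gcongr
  have h5 : 5 * (5 * (c : ℝ) / ε * (4 * Real.log (T / β))) =
      100 * (ε⁻¹ * c * Real.log (T / β)) := by
    field_simp
    ring
  linarith

/-- To achieve `C` times a minimum, it suffices to treat each of its terms where it is smallest. -/
lemma achievable_min {d T K : ℕ} {ε δ β C A₃ A₄ : ℝ} (hε : 0 < ε) (hδ : 0 ≤ δ) (hβ : 0 < β)
    (hC : 1 ≤ C) (h3 : 1 ≤ (K : ℝ) → A₃ ≤ K → A₃ ≤ A₄ → Achievable d T K ε δ β (C * A₃))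
    (h4 : 1 ≤ (K : ℝ) → A₄ ≤ A₃ → Achievable d T K ε δ β (C * A₄)) (h30 : 0 ≤ A₃) (h40 : 0 ≤ A₄) :
    Achievable d T K ε δ β (C * min (min (d : ℝ) K) (min A₃ A₄)) := by
  have h0 : (0 : ℝ) ≤ min (d : ℝ) K := le_min (Nat.cast_nonneg _) (Nat.cast_nonneg _)
  have hzero : min (d : ℝ) K ≤ min A₃ A₄ →
      Achievable d T K ε δ β (C * min (min (d : ℝ) K) (min A₃ A₄)) := by
    intro h
    rw [min_eq_left h]
    exact (achievable_zero d T K hε.le hβ).mono hδ (le_mul_of_one_le_left h0 hC)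
  rcases Nat.eq_zero_or_pos K with hK | hK
  · exact hzero (by simp [hK, h30, h40])
  have hK' : (1 : ℝ) ≤ K := by exact_mod_cast hK
  rcases le_total (min (d : ℝ) K) (min A₃ A₄) with h | h
  · exact hzero h
  rw [min_eq_right h]
  rcases le_total A₃ A₄ with h34 | h34
  · rw [min_eq_left h34] at h ⊢
    exact h3 hK' (h.trans (min_le_right _ _)) h34
  · rw [min_eq_right h34]
    exact h4 hK' h34

/-- With `α = A` and `c` about `K / A`, the noise term `ε⁻¹ * c * Λ` is at most `2 * A`, so the
constant is `100 * 2 + 1`. -/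
lemma achievable_pure {d T K : ℕ} {β ε : ℝ} (hT : 0 < T) (hβ : 0 < β) (hβ1 : β < 1)
    (hε : 0 < ε) :
    Achievable d T K ε 0 β
      (201 * min (min (d : ℝ) (K : ℝ))
        (min (Real.sqrt (ε⁻¹ * K * Real.log (T / β))) (ε⁻¹ * T * Real.log (T / β)))) := by
  have hT' : (0 : ℝ) < T := by exact_mod_cast hT
  have hΛ := log_div_pos hT hβ hβ1
  set Λ := Real.log (T / β) with hΛdef
  have hlap : Achievable d T K ε 0 β (201 * (ε⁻¹ * T * Λ)) :=
    (achievable_laplace hT hε hβ hβ1).mono le_rfl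
      (le_mul_of_one_le_left (by positivity) (by norm_num))
  refine achievable_min hε le_rfl hβ (by norm_num) (fun hK h3 h34 => ?_) (fun _ _ => hlap)
    (Real.sqrt_nonneg _) (by positivity)
  set A := Real.sqrt (ε⁻¹ * K * Λ) with hA
  have hApos : 0 < A := Real.sqrt_pos.2 (by positivity)
  have hAsq : A * A = ε⁻¹ * K * Λ := Real.mul_self_sqrt (by positivity)
  rcases lt_or_ge Λ (Real.log 2) with hlog | hlog
  · have hT1 : T = 1 := eq_one_of_log_div_lt hT hβ hβ1 hlog
    refine hlap.mono le_rfl (mul_le_mul_of_nonneg_left ?_ (by norm_num))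
    have h5 : ε⁻¹ * Λ * A ≤ A * A := by
      rw [hAsq]
      calc ε⁻¹ * Λ * A ≤ ε⁻¹ * Λ * K := by gcongr
        _ = _ := by ring
    have h6 := le_of_mul_le_mul_right h5 hApos
    rwa [hT1, Nat.cast_one, mul_one]
  · obtain ⟨c, hc, hKc, hcK⟩ := exists_budget hApos h3
    refine (achievable_sparse_of_log hT hε hβ hβ1 hc hApos.le hKc hlog).mono le_rfl ?_
    have h5 : ε⁻¹ * c * Λ * A ≤ (2 * A) * A := by
      calc ε⁻¹ * c * Λ * A = ε⁻¹ * Λ * (c * A) := by ring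
        _ ≤ ε⁻¹ * Λ * (2 * K) := by gcongr
        _ = (2 * A) * A := by rw [mul_assoc 2 A, hAsq]; ring
    have h6 := le_of_mul_le_mul_right h5 hApos
    linarith

lemma achievable_gaussian_of_log {d T K : ℕ} {β ε L L₀ : ℝ} (hT : 0 < T) (hβ : 0 < β)
    (hβ1 : β < 1) (hε : 0 < ε) (hε1 : ε < 1) (hL₀ : 0 < L₀) (hL : L₀ ≤ L)
    (hlog : Real.log 2 ≤ Real.log (T / β)) :
    Achievable d T K ε (Real.exp (-L)) β
      (2 * Real.sqrt (8 + L₀⁻¹) * (ε⁻¹ * Real.sqrt (T * L * Real.log (T / β)))) := by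
  have hT' : (0 : ℝ) < T := by exact_mod_cast hT
  have hL' : 0 < L := hL₀.trans_le hL
  have hΛ := log_div_pos hT hβ hβ1
  -- Each summand of the privacy condition must be at most half of `ε * s`: the square root needs `κ
  -- ≥ 8`, and `T / 2` needs `κ * L ≥ ε`, which `L₀⁻¹` ensures.
  set κ := 8 + L₀⁻¹ with hκ
  have hκ8 : 8 ≤ κ := by
    have := inv_pos.2 hL₀
    linarith
  set s := κ * (T * L) / ε ^ 2 with hs
  have hs0 : 0 < s := by positivity
  refine (achievable_gaussian (s := s) hT hβ hβ1 hs0 hL'.le ?_).mono le_rfl ?_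
  · have h1 : Real.sqrt (2 * s * T * L) ≤ κ / 2 * (T * L) / ε := by
      refine Real.sqrt_le_iff.2 ⟨by positivity, ?_⟩
      have h2 : 2 * s * T * L = 2 * κ * ((T * L) / ε) ^ 2 := by
        rw [hs]; field_simp
      have h3 : (κ / 2 * (T * L) / ε) ^ 2 = κ ^ 2 / 4 * ((T * L) / ε) ^ 2 := by ring
      rw [h2, h3]
      gcongr
      nlinarith
    have h4 : (T : ℝ) / 2 ≤ κ / 2 * (T * L) / ε := by
      have h5 : 1 ≤ κ * L := by
        calc (1 : ℝ) = L₀⁻¹ * L₀ := (inv_mul_cancel₀ hL₀.ne').symm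
          _ ≤ κ * L := by gcongr; linarith
      rw [le_div_iff₀ hε]
      have h6 : (T : ℝ) * ε ≤ T * (κ * L) := by gcongr; linarith
      linarith
    have h7 : ε * s = κ / 2 * (T * L) / ε + κ / 2 * (T * L) / ε := by
      rw [hs]; field_simp; ring
    linarith
  · have h1 : Real.log (2 * T / β) ≤ 2 * Real.log (T / β) := by
      rw [mul_div_assoc]
      refine (log_mul_div_le (n := 1) (by norm_num) (by norm_num) hT' hβ hlog).trans_eq ?_
      norm_num
    refine Real.sqrt_le_iff.2 ⟨by positivity, ?_⟩
    rw [mul_pow, mul_pow, mul_pow, Real.sq_sqrt (by positivity), Real.sq_sqrt (by positivity)]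
    calc 2 * s * Real.log (2 * T / β) ≤ 2 * s * (2 * Real.log (T / β)) := by gcongr
      _ = _ := by rw [hs]; field_simp

lemma achievable_mask_of_log {d T K c : ℕ} {β ε L L₀ α : ℝ} (hT : 0 < T) (hβ : 0 < β)
    (hβ1 : β < 1) (hε : 0 < ε) (hε1 : ε < 1) (hL₀ : 0 < L₀) (hL : L₀ ≤ L) (hc : 0 < c)
    (hα : 0 ≤ α) (hK : (K : ℝ) ≤ c * α) (hcL : L ≤ c) :
    Achievable d T K ε (Real.exp (-L)) β
      (18 * (2 + 2 * L₀⁻¹) * (ε⁻¹ * Real.sqrt (c * L) * Real.log (T / β)) + α) := by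
  have hc' : (0 : ℝ) < c := by exact_mod_cast hc
  have hL' : 0 < L := hL₀.trans_le hL
  set γ := 2 + 2 * L₀⁻¹ with hγ
  have hγ0 : 0 < γ := by positivity
  set r := Real.sqrt (c * L) with hr
  have hr0 : 0 < r := Real.sqrt_pos.2 (by positivity)
  have hrsq : r ^ 2 = c * L := Real.sq_sqrt (by positivity)
  have hLr : L ≤ r := Real.le_sqrt_of_sq_le (by nlinarith)
  -- This makes `ε * k ≥ 2 * L`, while `b` below is chosen so that the moment cost is at most `L`;
  -- the difference leaves `exp (-L)`. The summand `2 * L₀⁻¹` of `γ` absorbs the rounding in `k +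
  -- 1`.
  set k := ⌈2 * L / ε⌉₊ with hk
  have hk1 : 2 * L ≤ ε * k := by
    have := Nat.le_ceil (2 * L / ε)
    rw [div_le_iff₀ hε] at this
    linarith
  have hk2 : ((k + 1 : ℕ) : ℝ) ≤ γ * L / ε := by
    have h1 := (Nat.ceil_lt_add_one (by positivity : 0 ≤ 2 * L / ε)).le
    have h2 : 1 ≤ L₀⁻¹ * L / ε := by
      rw [le_div_iff₀ hε, one_mul]
      calc ε ≤ L₀⁻¹ * L₀ := by rw [inv_mul_cancel₀ hL₀.ne']; exact hε1.le
        _ ≤ L₀⁻¹ * L := by gcongr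
    have h3 : γ * L / ε = 2 * L / ε + 2 * (L₀⁻¹ * L / ε) := by rw [hγ]; ring
    push_cast
    linarith
  set b := 6 * γ * r / ε with hb
  have hb0 : 0 < b := by positivity
  have hb4 : 4 * ((k + 1 : ℕ) : ℝ) ≤ b := by
    calc 4 * ((k + 1 : ℕ) : ℝ) ≤ 4 * (γ * L / ε) := by gcongr
      _ ≤ 6 * (γ * r / ε) := by gcongr; norm_num
      _ = b := by rw [hb]; ring
  refine (achievable_mask (k := k) (ε := ε) (b := b) hT hβ hβ1 hc hα hK hb4).mono
    (Real.exp_le_exp.2 ?_) (le_of_eq ?_)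
  · have h1 : ((k + 1 : ℕ) : ℝ) * (2 / b) ≤ L / (3 * r) := by
      calc ((k + 1 : ℕ) : ℝ) * (2 / b) ≤ γ * L / ε * (2 / b) := by gcongr
        _ = L / (3 * r) := by rw [hb]; field_simp; norm_num
    have h2 : 8 * (((k + 1 : ℕ) : ℝ) * (2 / b)) ^ 2 * c ≤ L := by
      calc 8 * (((k + 1 : ℕ) : ℝ) * (2 / b)) ^ 2 * c ≤ 8 * (L / (3 * r)) ^ 2 * c := by gcongr
        _ = 8 / 9 * L := by
          rw [div_pow, mul_pow, hrsq]
          field_simp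
          norm_num
        _ ≤ L := by linarith
    linarith
  · rw [hb]; field_simp; ring

lemma achievable_approx {d T K : ℕ} {β ε L L₀ : ℝ} (hT : 0 < T) (hβ : 0 < β)
    (hβ1 : β < 1) (hε : 0 < ε) (hε1 : ε < 1) (hL₀ : 0 < L₀) (hL : L₀ ≤ L) :
    Achievable d T K ε (Real.exp (-L)) β
      ((201 + (Real.sqrt L₀)⁻¹ + 2 * Real.sqrt (8 + L₀⁻¹) + 36 * (2 + 2 * L₀⁻¹)) *
        min (min (d : ℝ) (K : ℝ))
          (min ((ε⁻¹ ^ 2 * K * L * Real.log (T / β) ^ 2) ^ ((1 : ℝ) / 3))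
            (ε⁻¹ * Real.sqrt (T * L * Real.log (T / β))))) := by
  have hT' : (0 : ℝ) < T := by exact_mod_cast hT
  have hL' : 0 < L := hL₀.trans_le hL
  have hΛ := log_div_pos hT hβ hβ1
  have hδ := (Real.exp_pos (-L)).le
  set Λ := Real.log (T / β) with hΛdef
  have hC1 : 0 ≤ (Real.sqrt L₀)⁻¹ := by positivity
  have hC2 : 0 ≤ 2 * Real.sqrt (8 + L₀⁻¹) := by positivity
  have hC3 : 0 ≤ 36 * (2 + 2 * L₀⁻¹) := by positivity
  set C := 201 + (Real.sqrt L₀)⁻¹ + 2 * Real.sqrt (8 + L₀⁻¹) + 36 * (2 + 2 * L₀⁻¹) with hC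
  set A := (ε⁻¹ ^ 2 * K * L * Λ ^ 2) ^ ((1 : ℝ) / 3) with hA
  have hA0 : 0 ≤ A := by positivity
  have hA3 : A ^ 3 = ε⁻¹ ^ 2 * K * L * Λ ^ 2 := by
    rw [hA, ← Real.rpow_natCast, ← Real.rpow_mul (by positivity)]
    norm_num
  -- The fallback for one time step; comparing with a target that contains `L ≥ L₀` costs the factor
  -- `(√L₀)⁻¹`.
  have hlap : ∀ x : ℝ, T = 1 → ε⁻¹ * Real.sqrt L₀ * Λ ≤ x →
      Achievable d T K ε (Real.exp (-L)) β (C * x) := by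
    intro x hT1 hx
    have hx0 : 0 ≤ x := le_trans (by positivity) hx
    refine (achievable_laplace hT hε hβ hβ1).mono hδ ?_
    have hs : 0 < Real.sqrt L₀ := Real.sqrt_pos.2 hL₀
    calc ε⁻¹ * T * Λ = (Real.sqrt L₀)⁻¹ * (ε⁻¹ * Real.sqrt L₀ * Λ) := by
          rw [hT1]; field_simp; simp
      _ ≤ (Real.sqrt L₀)⁻¹ * x := by gcongr
      _ ≤ C * x := by gcongr; linarith
  refine achievable_min hε hδ hβ (by linarith) (fun hK h3 h34 => ?_) (fun hK h43 => ?_) hA0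
    (by positivity)
  · have hApos : 0 < A := Real.rpow_pos_of_pos (by positivity) _
    rcases lt_or_ge Λ (Real.log 2) with hlog | hlog
    · refine hlap A (eq_one_of_log_div_lt hT hβ hβ1 hlog) ?_
      refine le_of_sq_le_sq ?_ hA0
      have h5 : (ε⁻¹ * Real.sqrt L₀ * Λ) ^ 2 * A ≤ A ^ 2 * A := by
        rw [mul_pow, mul_pow, Real.sq_sqrt hL₀.le, ← pow_succ, hA3]
        calc ε⁻¹ ^ 2 * L₀ * Λ ^ 2 * A ≤ ε⁻¹ ^ 2 * L * Λ ^ 2 * K := by gcongr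
          _ = _ := by ring
      exact le_of_mul_le_mul_right h5 hApos
    · obtain ⟨c, hc, hKc, hcK⟩ := exists_budget hApos h3
      have hc' : (0 : ℝ) < c := by exact_mod_cast hc
      -- The balance behind the cube root: for `c` about `K / A`, noise of scale `ε⁻¹ * √(c * L)`
      -- produces an error of order `A`.
      have hcA : ε⁻¹ ^ 2 * (c * L) * Λ ^ 2 ≤ (2 * A) ^ 2 := by
        have h5 : ε⁻¹ ^ 2 * (c * L) * Λ ^ 2 * A ≤ 2 * A ^ 2 * A := by
          calc ε⁻¹ ^ 2 * (c * L) * Λ ^ 2 * A = ε⁻¹ ^ 2 * L * Λ ^ 2 * (c * A) := by ring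
            _ ≤ ε⁻¹ ^ 2 * L * Λ ^ 2 * (2 * K) := by gcongr
            _ = 2 * A ^ 3 := by rw [hA3]; ring
            _ = 2 * A ^ 2 * A := by ring
        have h6 := le_of_mul_le_mul_right h5 hApos
        nlinarith
      -- The masked mechanism needs `L ≤ c`. For smaller budgets `c ≤ √(c * L)`, so the purely
      -- private sparse vector technique is already as good.
      rcases le_total (c : ℝ) L with hcL | hcL
      · refine (achievable_sparse_of_log hT hε hβ hβ1 hc hA0 hKc hlog).mono hδ ?_
        have h7 : ε⁻¹ * c * Λ ≤ 2 * A := by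
          refine le_of_sq_le_sq (le_trans ?_ hcA) (by positivity)
          calc (ε⁻¹ * c * Λ) ^ 2 = ε⁻¹ ^ 2 * (c * c) * Λ ^ 2 := by ring
            _ ≤ ε⁻¹ ^ 2 * (c * L) * Λ ^ 2 := by gcongr
        calc 100 * (ε⁻¹ * c * Λ) + A ≤ 201 * A := by linarith
          _ ≤ C * A := by gcongr; linarith
      · refine (achievable_mask_of_log hT hβ hβ1 hε hε1 hL₀ hL hc hA0 hKc hcL).mono le_rfl ?_
        have h7 : ε⁻¹ * Real.sqrt (c * L) * Λ ≤ 2 * A := by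
          refine le_of_sq_le_sq (le_trans (le_of_eq ?_) hcA) (by positivity)
          rw [mul_pow, mul_pow, Real.sq_sqrt (by positivity)]
        calc 18 * (2 + 2 * L₀⁻¹) * (ε⁻¹ * Real.sqrt (c * L) * Λ) + A
            ≤ 18 * (2 + 2 * L₀⁻¹) * (2 * A) + A := by gcongr
          _ = (36 * (2 + 2 * L₀⁻¹) + 1) * A := by ring
          _ ≤ C * A := by gcongr; linarith
  · rcases lt_or_ge Λ (Real.log 2) with hlog | hlog
    · have hT1 := eq_one_of_log_div_lt hT hβ hβ1 hlog
      refine hlap _ hT1 ?_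
      rw [mul_assoc]
      refine mul_le_mul_of_nonneg_left ?_ (by positivity)
      refine Real.le_sqrt_of_sq_le ?_
      have hΛ1 : Λ ≤ 1 := by linarith [Real.log_two_lt_d9]
      rw [mul_pow, Real.sq_sqrt hL₀.le, hT1, Nat.cast_one, one_mul]
      have : Λ ^ 2 ≤ Λ := by nlinarith
      gcongr
    · refine (achievable_gaussian_of_log hT hβ hβ1 hε hε1 hL₀ hL hlog).mono le_rfl ?_
      gcongr
      linarith

end CountDistinct

theorem theorem3p1 :
    (∃ C : ℝ, 0 < C ∧
      ∀ (d T K : ℕ) (β ε : ℝ), 0 < d → 0 < T → 0 < β → β < 1 → 0 < ε →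
        ∃ A : CountDistinct.ContinualAlgorithm d,
          A.IsItemLevelDP T ε 0 ∧
          A.HasErrorAtMost T K β
            (C * min (min (d : ℝ) (K : ℝ))
              (min (Real.sqrt (ε⁻¹ * K * Real.log (T / β)))
                (ε⁻¹ * T * Real.log (T / β))))) ∧
    (∀ δ₀ : ℝ, 0 < δ₀ → δ₀ < 1 → ∃ C : ℝ, 0 < C ∧
      ∀ (d T K : ℕ) (β ε δ : ℝ), 0 < d → 0 < T → 0 < β → β < 1 → 0 < ε → ε < 1 →
        0 < δ → δ ≤ δ₀ →
        ∃ A : CountDistinct.ContinualAlgorithm d,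
          A.IsItemLevelDP T ε δ ∧
          A.HasErrorAtMost T K β
            (C * min (min (d : ℝ) (K : ℝ))
              (min ((ε⁻¹ ^ 2 * K * Real.log (1 / δ) * Real.log (T / β) ^ 2) ^ ((1 : ℝ) / 3))
                (ε⁻¹ * Real.sqrt (T * Real.log (1 / δ) * Real.log (T / β)))))) := by
  refine ⟨⟨201, by norm_num, fun d T K β ε _ hT hβ hβ1 hε =>
    CountDistinct.achievable_pure hT hβ hβ1 hε⟩, fun δ₀ hδ₀ hδ₀1 => ?_⟩
  -- A positive lower bound for `log (1 / δ)`, uniform in `δ ≤ δ₀`; the constant depends on `δ₀`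
  -- only through it.
  have hL₀ : 0 < Real.log (1 / δ₀) := Real.log_pos ((one_lt_div hδ₀).2 hδ₀1)
  refine ⟨201 + (Real.sqrt (Real.log (1 / δ₀)))⁻¹ + 2 * Real.sqrt (8 + (Real.log (1 / δ₀))⁻¹) +
    36 * (2 + 2 * (Real.log (1 / δ₀))⁻¹), by positivity,
    fun d T K β ε δ _ hT hβ hβ1 hε hε1 hδ hδδ₀ => ?_⟩
  have hL : Real.log (1 / δ₀) ≤ Real.log (1 / δ) := by gcongr
  have h := CountDistinct.achievable_approx (d := d) (K := K) hT hβ hβ1 hε hε1 hL₀ hL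
  have hexp : Real.exp (-Real.log (1 / δ)) = δ := by
    rw [Real.exp_neg, Real.exp_log (by positivity), one_div, inv_inv]
  rw [hexp] at h
  exact h
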